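/- \textbf{Setting.} Let $\mathcal P$ be a groupoid of paths (edges) over a set $\Sigma$ of points; a generalised connection assigns to each path $e$ a holonomy $h_e\in SU(2)$ with $h_{e\circ f}=h_eh_f$ ($e$ followed by $f$). States are elements of $\mathrm{Cyl}\otimes\mathcal F_-$, where $\mathrm{Cyl}$ is the algebra of continuous cylindrical functions of the connection and $\mathcal F_-$ is the (algebraic) fermionic Fock space over the finitely supported functions $\Sigma\to\mathbb C^2$, with creation operators $\theta^A(x)$. Put $S_x^i=\tfrac12\,\theta(x)\sigma_i\theta^\dagger(x)$. Let $E=\{e_1,\dots,e_n\}$ be edges with pairwise distinct initial points $s(e_a)$ and a common endpoint $t(E)$, and let $S_E^i=\sum_a\sum_j \pi_1(h_{e_a}^{-1})^i{}_j\,S^j_{s(e_a)}$ and $(S_E)^2=\sum_i S_E^iS_E^i$, where $\pi_1$ is the spin-$1$ representation. Let $p,q$ be paths from $t(E)$ to two points, the \emph{top} and the \emph{bottom} point of outflow. \textbf{Diagrams.} Let $2j,2k\in\mathbb N_0$. There is one fermion at each $s(e_a)$, and each fermion is declared \emph{increasing} or \emph{reducing} (it raises or lowers the spin from top to bottom). A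 binor diagram consists of spin-$\frac12$ lines joining the $n$ fermions, $2k$ lines flowing out at the top point and $2j$ lines flowing out at the bottom point in pairs. It denotes the state with $2k+2j$ open spinor indices in which every line carries the holonomy through $t(E)$ (along the $e_a$, $p$, $q$), a line between two fermions or between two outflowing lines is contracted with the binor line $i\epsilon$, and the fermions are created from the vacuum in the fixed order $1,\dots,n$. If fermions $a,b$ are joined to outflowing lines $s,t$, the \emph{reduction} by $(a,b)$ replaces the lines $a$–$s$ and $b$–$t$ by $a$–$b$ and $s$–$t$; if $a$ or $b$ is not joined to an outflowing line, there is no reduction and the corresponding term is $0$. For a diagram $D$ let $$\Psi_D=\operatorname{Sym}\ \sum_{m\ge 0}\ \sum_{a_1<b_1,\dots,a_m<b_m}\lambda_{a_1b_1\cdots a_mb_m}\;D_{a_1b_1\cdots a_mb_m},$$ where the inner sum is over ordered sequences of $m$ pairs of fermions, $D_{a_1b_1\cdots a_mb_m}$ is the state obtained by the successive reductions, and $\operatorname{Sym}$ symmetrises the $2k$ open indices at the top point and the $2j$ open indices at the bottom point. The coefficients are $\lambda_{a_1b_1\cdots a_mb_m}=0$ if some pair $(a_i,b_i)$ consists of two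 fermions of the same type, and otherwise $\lambda_{a_1b_1\cdots a_mb_m}=\lambda_m$ with $$\lambda_0=1,\qquad \lambda_m^{-1}=m\,(2j+2k-m+1)\,\lambda_{m-1}^{-1}.$$ \textbf{Proposition.} In each of the following two cases the state is a nonzero eigenstate of $(S_E)^2$ with total spin $j+k$: every component satisfies $(S_E)^2\Psi=(j+k)(j+k+1)\Psi$, and not all components vanish. (1) \emph{Chains.} The fermions $1,\dots,n$ sit in this order on a chain of holonomies from the top to the bottom point. It starts with spin $k$ and ends with spin $j$, each fermion raises or lowers the spin by $\frac12$ according to its type, the spin is never negative, and a spin-$h/2$ holonomy is the symmetrisation of $h$ spin-$\frac12$ lines. There are no pure holonomies between the two points of outflow, i.e. the spin is $0$ somewhere along the chain. The chain is a linear combination of diagrams (dissolve all symmetrisations), and $\Psi$ is the same linear combination of the states $\Psi_D$. (2) \emph{Products of building blocks.} $\Psi=\Psi_D$ for a diagram $D$ in which each of the $2k$ top lines ends at a reducing fermion, each of the $2j$ bottom lines at an increasing fermion, and the remaining fermions are joined in pairs of one increasing and one reducing fermion. -/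

import Mathlib

open CategoryTheory
open scoped TensorProduct

namespace LoopSpin

universe u v

noncomputable section

/-! ### Connections, cylindrical functions, fermionic Fock space -/

/-- The gauge group. -/
abbrev SU2 := Matrix.specialUnitaryGroup (Fin 2) ℂ

/-- A generalised connection on the points `Pt`, whose edges (paths) form a groupoid: every edge
has a holonomy in SU(2), and `h_{e ∘ f} = h_e h_f`, where `e ∘ f` is `e` followed by `f`. The first
index of `h_e` belongs to the source of `e`, the second one to its target. -/
structure Connection (Pt : Type u) [Groupoid.{v} Pt] where
  hol : ∀ {x y : Pt}, (x ⟶ y) → SU2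
  hol_comp : ∀ {x y z : Pt} (e : x ⟶ y) (f : y ⟶ z), hol (e ≫ f) = hol e * hol f

/-- The edges of the groupoid, with arbitrary endpoints. -/
abbrev Edge (Pt : Type u) [Groupoid.{v} Pt] := Σ x y : Pt, (x ⟶ y)

/-- A function of the connection is cylindrical if it is a continuous function of the holonomies
along finitely many edges. -/
def IsCylindrical {Pt : Type u} [Groupoid.{v} Pt] (f : Connection Pt → ℂ) : Prop :=
  ∃ (ι : Type) (_ : Finite ι) (e : ι → Edge Pt) (F : (ι → SU2) → ℂ),
    Continuous F ∧ ∀ A : Connection Pt, f A = F fun i => A.hol (e i).2.2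

theorem isCylindrical_const {Pt : Type u} [Groupoid.{v} Pt] (c : ℂ) :
    IsCylindrical (fun _ : Connection Pt => c) :=
  ⟨Empty, inferInstance, Empty.elim, fun _ => c, continuous_const, fun _ => rfl⟩

theorem IsCylindrical.map₂ {Pt : Type u} [Groupoid.{v} Pt] {f g : Connection Pt → ℂ}
    (hf : IsCylindrical f) (hg : IsCylindrical g) (op : ℂ → ℂ → ℂ)
    (hop : Continuous fun z : ℂ × ℂ => op z.1 z.2) :
    IsCylindrical fun A => op (f A) (g A) := by
  obtain ⟨ι, hι, e, F, hF, hfF⟩ := hf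
  obtain ⟨κ, hκ, e', G, hG, hgG⟩ := hg
  refine ⟨ι ⊕ κ, inferInstance, Sum.elim e e',
    fun h => op (F fun i => h (Sum.inl i)) (G fun i => h (Sum.inr i)), ?_, ?_⟩
  · have h1 : Continuous fun h : ι ⊕ κ → SU2 => F fun i => h (Sum.inl i) :=
      hF.comp (continuous_pi fun i => continuous_apply _)
    have h2 : Continuous fun h : ι ⊕ κ → SU2 => G fun i => h (Sum.inr i) :=
      hG.comp (continuous_pi fun i => continuous_apply _)
    exact hop.comp (h1.prodMk h2)
  · intro A
    show op (f A) (g A) = _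
    rw [hfF, hgG]
    rfl

/-- The algebra of cylindrical functions: the dense subspace of the Ashtekar-Lewandowski space on
which holonomies act by multiplication. -/
def Cyl (Pt : Type u) [Groupoid.{v} Pt] : Subalgebra ℂ (Connection Pt → ℂ) where
  carrier := {f | IsCylindrical f}
  mul_mem' hf hg := hf.map₂ hg (· * ·) continuous_mul
  add_mem' hf hg := hf.map₂ hg (· + ·) continuous_add
  algebraMap_mem' c := isCylindrical_const c

/-- The holonomy along `e` in the spin 1/2 representation, as a matrix of cylindrical functions. -/
def holMatrix {Pt : Type u} [Groupoid.{v} Pt] {x y : Pt} (e : x ⟶ y) :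
    Matrix (Fin 2) (Fin 2) (Cyl Pt) :=
  fun B C => ⟨fun A => (A.hol e : Matrix (Fin 2) (Fin 2) ℂ) B C,
    Unit, inferInstance, fun _ => ⟨x, y, e⟩, fun h => (h () : Matrix (Fin 2) (Fin 2) ℂ) B C,
    (continuous_subtype_val.comp (continuous_apply ())).matrix_elem B C, fun _ => rfl⟩

/-- The Pauli matrices. -/
def pauli : Fin 3 → Matrix (Fin 2) (Fin 2) ℂ
  | 0 => !![0, 1; 1, 0]
  | 1 => !![0, -Complex.I; Complex.I, 0]
  | 2 => !![1, 0; 0, -1]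

/-- The holonomy in the spin 1 representation:
`π₁(h_e)_{ij} = (1/2) tr (σ_i h_e σ_j h_e⁻¹)`. -/
def holMatrix₁ {Pt : Type u} [Groupoid.{v} Pt] {x y : Pt} (e : x ⟶ y) :
    Matrix (Fin 3) (Fin 3) (Cyl Pt) :=
  fun i j => (2⁻¹ : ℂ) • Matrix.trace
    ((pauli i).map (algebraMap ℂ (Cyl Pt)) * holMatrix e *
      (pauli j).map (algebraMap ℂ (Cyl Pt)) * holMatrix (Groupoid.inv e))

/-- One-particle space: finitely supported functions from the points to `ℂ²`. -/
abbrev OneParticle (Pt : Type u) := Pt →₀ (Fin 2 → ℂ)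

/-- (Algebraic) fermionic Fock space over the one-particle space, with vacuum `1`. -/
abbrev Fock (Pt : Type u) := ExteriorAlgebra ℂ (OneParticle Pt)

/-- The creation operator `θ^A(x)`. -/
def create {Pt : Type u} (x : Pt) (A : Fin 2) : Module.End ℂ (Fock Pt) :=
  LinearMap.mulLeft ℂ (ExteriorAlgebra.ι ℂ (Finsupp.single x (Pi.single A (1 : ℂ))))

/-- The annihilation operator `θ†_A(x)`: contraction with the functional `f ↦ f(x)_A`. -/
def annihilate {Pt : Type u} (x : Pt) (A : Fin 2) : Module.End ℂ (Fock Pt) :=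
  CliffordAlgebra.contractLeft (Q := (0 : QuadraticForm ℂ (OneParticle Pt)))
    ((LinearMap.proj A : (Fin 2 → ℂ) →ₗ[ℂ] ℂ) ∘ₗ Finsupp.lapply x)

/-- The fermion spin at the point `x`: `S_x^i = (1/2) θ(x) σ_i θ†(x)`. -/
def spinAt {Pt : Type u} (x : Pt) (i : Fin 3) : Module.End ℂ (Fock Pt) :=
  (2⁻¹ : ℂ) • ∑ A : Fin 2, ∑ B : Fin 2, pauli i A B • (create x A * annihilate x B)

/-- The state space of gravity and fermions (its dense subspace of cylindrical functions tensored
with finite-particle fermion states). -/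
abbrev States (Pt : Type u) [Groupoid.{v} Pt] := Cyl Pt ⊗[ℂ] Fock Pt

/-- A cylindrical function and an operator on Fock space act on the respective tensor factors. -/
def act {Pt : Type u} [Groupoid.{v} Pt] (f : Cyl Pt) (T : Module.End ℂ (Fock Pt)) :
    Module.End ℂ (States Pt) :=
  TensorProduct.map (LinearMap.mulLeft ℂ f) T

/-! ### Total spin -/

/-- `n` edges with distinct initial points and a common endpoint. -/
structure EdgeSet (Pt : Type u) [Groupoid.{v} Pt] (n : ℕ) where
  source : Fin n → Pt
  target : Pt
  edge : ∀ a, source a ⟶ target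
  source_injective : Function.Injective source

/-- The parallel transported spin `S_e^i = ∑_j π₁(h_e⁻¹)_{ij} S_{s(e)}^j`. -/
def transportedSpin {Pt : Type u} [Groupoid.{v} Pt] {x y : Pt} (e : x ⟶ y) (i : Fin 3) :
    Module.End ℂ (States Pt) :=
  ∑ j : Fin 3, act (holMatrix₁ (Groupoid.inv e) i j) (spinAt x j)

/-- The total spin `S_E^i = ∑_{e ∈ E} S_e^i`. -/
def totalSpin {Pt : Type u} [Groupoid.{v} Pt] {n : ℕ} (E : EdgeSet Pt n) (i : Fin 3) :
    Module.End ℂ (States Pt) :=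
  ∑ a : Fin n, transportedSpin (E.edge a) i

/-- The squared total spin `(S_E)²`. -/
def totalSpinSq {Pt : Type u} [Groupoid.{v} Pt] {n : ℕ} (E : EdgeSet Pt n) :
    Module.End ℂ (States Pt) :=
  ∑ i : Fin 3, totalSpin E i * totalSpin E i

/-- The creation operator of a fermion at the source of `e`, with its spinor index transported by
the holonomy to the endpoint of `e`. -/
def dressedCreate {Pt : Type u} [Groupoid.{v} Pt] {x y : Pt} (e : x ⟶ y) (A : Fin 2) :
    Module.End ℂ (States Pt) :=
  ∑ B : Fin 2, act (holMatrix e B A) (create x B)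

/-- The states `Ψ_E^{A_1 ⋯ A_n}`: one fermion at the source of each edge of `E`, all the spinor
indices being transported to the common endpoint. -/
def basicState {Pt : Type u} [Groupoid.{v} Pt] {n : ℕ} (E : EdgeSet Pt n) (A : Fin n → Fin 2) :
    States Pt :=
  (List.ofFn fun a => dressedCreate (E.edge a) (A a)).prod (1 ⊗ₜ[ℂ] 1)

/-! ### Binor diagrams with two points of outflow -/

/-- The spin 1/2 lines that leave at the two points of outflow: `twok` lines at the top one and
`twoj` lines at the bottom one. -/
abbrev Outflow (twok twoj : ℕ) := Fin twok ⊕ Fin twoj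

/-- A binor diagram without symmetrisations: a list of spin 1/2 lines, each one joining a fermion
to an outflowing line, or two fermions, or two outflowing lines (a pure holonomy). -/
structure Diagram (n twok twoj : ℕ) where
  legs : List (Fin n × Outflow twok twoj)
  links : List (Fin n × Fin n)
  holonomies : List (Outflow twok twoj × Outflow twok twoj)

/-- The binor line `i ε_{AB}`, with `ε_{01} = 1`. -/
def binor : Matrix (Fin 2) (Fin 2) ℂ := Complex.I • !![0, 1; -1, 0]

/-- The holonomy from the common endpoint to the point of outflow, along `p` for the top point and
along `q` for the bottom one. -/
def outflowHol {Pt : Type u} [Groupoid.{v} Pt] {t top bot : Pt} {twok twoj : ℕ}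
    (p : t ⟶ top) (q : t ⟶ bot) : Outflow twok twoj → Matrix (Fin 2) (Fin 2) (Cyl Pt)
  | Sum.inl _ => holMatrix p
  | Sum.inr _ => holMatrix q

/-- The state given by a diagram. All the lines run through the common endpoint of `E`, and the
outflowing lines on to their point of outflow, where they end in the open indices `A`. Two
fermions are joined by a holonomy that is contracted with `i ε` into a singlet, and so are two
outflowing lines. -/
def Diagram.eval {Pt : Type u} [Groupoid.{v} Pt] {n twok twoj : ℕ} (E : EdgeSet Pt n)
    {top bot : Pt} (p : E.target ⟶ top) (q : E.target ⟶ bot)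
    (D : Diagram n twok twoj) (A : Outflow twok twoj → Fin 2) : States Pt :=
  ∑ C : Fin n → Fin 2,
    ((D.legs.map fun l => outflowHol p q l.2 (C l.1) (A l.2)).prod *
      (D.links.map fun l => algebraMap ℂ (Cyl Pt) (binor (C l.1) (C l.2))).prod *
      (D.holonomies.map fun l => ∑ F : Fin 2, ∑ G : Fin 2,
        algebraMap ℂ (Cyl Pt) (binor F G) *
          outflowHol p q l.1 F (A l.1) * outflowHol p q l.2 G (A l.2)).prod) •
      basicState E C

/-- The reduction of a diagram by the fermions `a` and `b`: if they are joined to the outflowing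
lines `s` and `t`, these two lines are replaced by one line from `a` to `b` and one from `s` to `t`.
There is no reduction if `a` or `b` is not joined to a point of outflow. -/
def Diagram.reduce {n twok twoj : ℕ} (D : Diagram n twok twoj) (c : Fin n × Fin n) :
    Option (Diagram n twok twoj) :=
  match D.legs.find? (fun l => l.1 = c.1), D.legs.find? (fun l => l.1 = c.2) with
  | some l, some l' => some
      { legs := D.legs.filter fun m => m.1 ≠ c.1 ∧ m.1 ≠ c.2
        links := c :: D.links
        holonomies := (l.2, l'.2) :: D.holonomies }
  | _, _ => none

/-- Successive reductions by a list of pairs of fermions. -/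
def Diagram.reduceAll {n twok twoj : ℕ} (D : Diagram n twok twoj) :
    List (Fin n × Fin n) → Option (Diagram n twok twoj)
  | [] => some D
  | c :: cs => (D.reduce c).bind fun D' => D'.reduceAll cs

/-- The state of the diagram that results from successive reductions. -/
def Diagram.evalReduced {Pt : Type u} [Groupoid.{v} Pt] {n twok twoj : ℕ} (E : EdgeSet Pt n)
    {top bot : Pt} (p : E.target ⟶ top) (q : E.target ⟶ bot)
    (D : Diagram n twok twoj) (cs : List (Fin n × Fin n)) (A : Outflow twok twoj → Fin 2) :
    States Pt :=
  match D.reduceAll cs with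
  | some D' => D'.eval E p q A
  | none => 0

/-- Looking from the top point of outflow to the bottom one, a fermion either increases or reduces
the spin of the holonomy. -/
inductive FermionType
  | increasing
  | reducing
  deriving DecidableEq

/-- The inverse coefficients: `λ_0⁻¹ = 1` and `λ_m⁻¹ = m (2j + 2k - m + 1) λ_{m-1}⁻¹`. -/
def invCoeff (twok twoj : ℕ) : ℕ → ℂ
  | 0 => 1
  | m + 1 => ((m + 1 : ℕ) : ℂ) * ((twoj : ℂ) + (twok : ℂ) - ((m + 1 : ℕ) : ℂ) + 1) *
      invCoeff twok twoj m

/-- The pairs `a < b` of fermions. -/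
abbrev FermionPair (n : ℕ) := {c : Fin n × Fin n // c.1 < c.2}

open Classical in
/-- The coefficient `λ_{a_1 b_1 … a_m b_m}`: zero if some pair consists of two fermions of the same
type, and `λ_m` otherwise. -/
def coeff {n : ℕ} (τ : Fin n → FermionType) (twok twoj : ℕ) {m : ℕ} (r : Fin m → FermionPair n) :
    ℂ :=
  if ∃ i, τ (r i).1.1 = τ (r i).1.2 then 0 else (invCoeff twok twoj m)⁻¹

/-- The linear combination of all successive reductions of a diagram, over
`a_1 < b_1, …, a_m < b_m` for all `m` (at most `n / 2` reductions are possible). -/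
def Diagram.series {Pt : Type u} [Groupoid.{v} Pt] {n twok twoj : ℕ} (E : EdgeSet Pt n)
    {top bot : Pt} (p : E.target ⟶ top) (q : E.target ⟶ bot) (τ : Fin n → FermionType)
    (D : Diagram n twok twoj) (A : Outflow twok twoj → Fin 2) : States Pt :=
  ∑ m ∈ Finset.range (n / 2 + 1), ∑ r : Fin m → FermionPair n,
    coeff τ twok twoj r • D.evalReduced E p q (List.ofFn fun i => (r i).1) A

/-- Symmetrisation of the outflowing lines at each of the two points of outflow. -/
def symmetriseOutflow {M : Type*} [AddCommGroup M] [Module ℂ M] {twok twoj : ℕ}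
    (Ψ : (Outflow twok twoj → Fin 2) → M) (A : Outflow twok twoj → Fin 2) : M :=
  ((twok.factorial * twoj.factorial : ℕ) : ℂ)⁻¹ •
    ∑ ρ : Equiv.Perm (Fin twok), ∑ κ : Equiv.Perm (Fin twoj), Ψ (A ∘ Sum.map ρ κ)

/-! ### Products of building blocks -/

/-- The diagrams that are products of the elementary blocks: reducing fermions joined to the top
point of outflow, increasing fermions joined to the bottom point, and singlets of one increasing and
one reducing fermion. Each fermion and each outflowing line occurs once, and there are no pure
holonomies between the points of outflow. -/
structure Diagram.IsBlockProduct {n twok twoj : ℕ} (τ : Fin n → FermionType)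
    (D : Diagram n twok twoj) : Prop where
  holonomies_eq : D.holonomies = []
  fermions_nodup :
    (D.legs.map Prod.fst ++ (D.links.map Prod.fst ++ D.links.map Prod.snd)).Nodup
  fermions_mem :
    ∀ a, a ∈ D.legs.map Prod.fst ++ (D.links.map Prod.fst ++ D.links.map Prod.snd)
  outflow_nodup : (D.legs.map Prod.snd).Nodup
  outflow_mem : ∀ s, s ∈ D.legs.map Prod.snd
  top_type : ∀ a i, (a, Sum.inl i) ∈ D.legs → τ a = FermionType.reducing
  bot_type : ∀ a i, (a, Sum.inr i) ∈ D.legs → τ a = FermionType.increasing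
  link_type : ∀ l ∈ D.links, τ l.1 ≠ τ l.2

/-! ### Chains of fermions and symmetrised holonomies -/

/-- Twice the spin of the holonomy below the first `i` fermions of a chain that starts with spin
`k` at the top. -/
def chainSpin {n : ℕ} (τ : Fin n → FermionType) (twok : ℕ) (i : ℕ) : ℤ :=
  twok + ∑ a : Fin n, if a.1 < i then (if τ a = FermionType.increasing then 1 else -1) else 0

/-- A chain from spin `k` at the top to spin `j` at the bottom whose fermions change the spin by
`± 1/2`. There are no pure holonomies between the two points of outflow: somewhere the spin
is zero, so that no line runs from the top to the bottom. -/
structure IsChain {n : ℕ} (τ : Fin n → FermionType) (twok twoj : ℕ) : Prop where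
  nonneg : ∀ i ≤ n, 0 ≤ chainSpin τ twok i
  bottom : chainSpin τ twok n = twoj
  no_pure_holonomy : ∃ i ≤ n, chainSpin τ twok i = 0

/-- Symmetrisation of a list of parallel lines: the average over all their orders. -/
def symmetrise {α M : Type*} [AddCommGroup M] [Module ℂ M] (l : List α) (f : List α → M) : M :=
  ((l.length.factorial : ℕ) : ℂ)⁻¹ • (l.permutations.map f).sum

/-- The line that comes from `x` (a line at the top point, or an increasing fermion) ends at the
reducing fermion `a`. -/
def Diagram.endAt {n twok twoj : ℕ} (D : Diagram n twok twoj) (x : Fin twok ⊕ Fin n) (a : Fin n) :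
    Diagram n twok twoj :=
  match x with
  | Sum.inl i => { D with legs := (a, Sum.inl i) :: D.legs }
  | Sum.inr b => { D with links := (b, a) :: D.links }

/-- The line that comes from `x` leaves at the bottom point of outflow as line `j`. -/
def Diagram.leave {n twok twoj : ℕ} (D : Diagram n twok twoj)
    (c : (Fin twok ⊕ Fin n) × Fin twoj) : Diagram n twok twoj :=
  match c.1 with
  | Sum.inl i => { D with holonomies := (Sum.inl i, Sum.inr c.2) :: D.holonomies }
  | Sum.inr b => { D with legs := (b, Sum.inr c.2) :: D.legs }

/-- Dissolving the symmetrisations of a chain. The fermions in the list `as` are still to be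
passed on the way down, `lines` are the spin 1/2 lines that make up the present holonomy, and `D`
is the part of the diagram that is already complete. The value of `f` on the chain is obtained
linearly from its values on the diagrams without symmetrisations. The symmetrisations at the points
of outflow are left to `symmetriseOutflow`. -/
def dissolve {M : Type*} [AddCommGroup M] [Module ℂ M] {n twok twoj : ℕ}
    (τ : Fin n → FermionType) (f : Diagram n twok twoj → M) :
    List (Fin n) → List (Fin twok ⊕ Fin n) → Diagram n twok twoj → M
  | [], lines, D => f ((lines.zip (List.finRange twoj)).foldl Diagram.leave D)
  | a :: as, lines, D => symmetrise lines fun l =>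
      match τ a, l with
      | FermionType.increasing, l => dissolve τ f as (l ++ [Sum.inr a]) D
      | FermionType.reducing, x :: xs => dissolve τ f as xs (D.endAt x a)
      | FermionType.reducing, [] => 0

/-- The linear combination of the chain and of all its successive reductions. -/
def chainSeries {Pt : Type u} [Groupoid.{v} Pt] {n : ℕ} (E : EdgeSet Pt n)
    {top bot : Pt} (p : E.target ⟶ top) (q : E.target ⟶ bot) (τ : Fin n → FermionType)
    (twok twoj : ℕ) (A : Outflow twok twoj → Fin 2) : States Pt :=
  dissolve τ (fun D : Diagram n twok twoj => D.series E p q τ A) (List.finRange n)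
    ((List.finRange twok).map Sum.inl) ⟨[], [], []⟩

/-! ### Eigenstates -/

/-- A state with open outflow indices is an eigenstate of `(S_E)²` with spin `s`: it is nonzero, and
each of its components satisfies the eigenvalue equation with eigenvalue `s (s + 1)`. -/
def IsSpinEigenstate {Pt : Type u} [Groupoid.{v} Pt] {n : ℕ} (E : EdgeSet Pt n) (s : ℂ)
    {ι : Type*} (Ψ : ι → States Pt) : Prop :=
  (∀ A, totalSpinSq E (Ψ A) = (s * (s + 1)) • Ψ A) ∧ Ψ ≠ 0

end

end LoopSpin

/-!
# Eigenstates of the total fermion spin from binor diagrams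

On the states `basicState E C`, with one fermion at the source of each edge and all spinor indices
transported to the common endpoint, the total spin acts on each index by Pauli matrices
(`totalSpin_basicState`): the spin 1 holonomies in its definition are exactly what the transport
requires. Since `∑ᵢ σᵢ ⊗ σᵢ = 2 swap - 1`, its square is, up to a constant, the sum of the exchanges
of two indices (`totalSpinSq_basicState`).

On a diagram the exchanges are as follows. The two fermions of a link form a singlet, so the
exchanges that involve them contribute a multiple of the diagram (`Diagram.IsProper.weight_swap_link`).
Exchanging two fermions on legs that flow out at the same point exchanges the outflowing lines, which
has no effect under the symmetrisation. Exchanging two fermions on legs that flow out at different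
points gives the diagram itself plus its reduction by these fermions
(`Diagram.IsProper.weight_swap_reduce`). Since the type of a fermion determines where its leg flows
out, a diagram with `N` legs satisfies
`S² D = N/2 (N/2 + 1) D + ∑ D_{ab}`, where the sum is over the pairs `a < b` of fermions of different
type (`Diagram.IsProper.totalSpinSq_symm_eval`). If `D` starts with `N = 2j + 2k` legs, the `m`-fold
reductions have `N - 2m` legs, and with `x = N/2`,
`x (x + 1) - (x - m) (x - m + 1) = m (N - m + 1)`; this is the factor in the recursion of the inverse
coefficients, so the series of reductions telescopes to an eigenstate
(`Diagram.IsProper.totalSpinSq_symm_series`).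

The state does not vanish because of its component in which all outflowing indices are `0`: a pure
holonomy between two outflowing lines is antisymmetric, so every reduction drops out of this
component, and only the diagram itself remains
(`Diagram.IsProper.coefficientAt_symm_series`). For a single diagram one reads off a nonzero
coefficient at the trivial connection.

A chain is an average of products of building blocks: as the spin vanishes at some cut, no line
crosses the cut, hence the top lines end above it, the bottom lines start below it, and each link
stays on one side (`ChainState`, `IsChain.dissolve_eq`). The eigenvalue equation is linear. For the
nonvanishing one has to exclude cancellations: choose the spinor indices such that the fermions that
may sit on legs, the reducing ones above and the increasing ones below the cut, have index `0`, and
the others have index `1`. Then a link contributes `-i` above and `i` below the cut, so all the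
diagrams of the chain have the same nonzero coefficient (`IsChainDiagram.weight_chainIndex`).
-/

open CategoryTheory
open scoped TensorProduct

namespace LoopSpin

universe u v

/-! ### The total spin operator on the basic states -/

section Pauli

/-- The Fierz identity `∑ᵢ σᵢ ⊗ σᵢ = 2 swap - 1`. -/
theorem pauli_fierz (A B C D : Fin 2) :
    ∑ i : Fin 3, pauli i A B * pauli i C D =
      2 * ((if A = D then 1 else 0) * (if C = B then 1 else 0)) -
        (if A = B then 1 else 0) * (if C = D then 1 else 0) := by
  fin_cases A <;> fin_cases B <;> fin_cases C <;> fin_cases D <;>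
    simp [Fin.sum_univ_three, pauli] <;> norm_num

theorem pauli_trace (i : Fin 3) : (pauli i).trace = 0 := by
  fin_cases i <;> simp [pauli, Matrix.trace, Fin.sum_univ_two]

/-- The completeness relation of the Pauli matrices, on traceless matrices. -/
theorem pauli_expand (M : Matrix (Fin 2) (Fin 2) ℂ) (hM : M.trace = 0) (A B : Fin 2) :
    ∑ j : Fin 3, pauli j A B * (2⁻¹ * (M * pauli j).trace) = M A B := by
  have h : M 1 1 = - M 0 0 := by
    rw [Matrix.trace_fin_two] at hM
    linear_combination hM
  fin_cases A <;> fin_cases B <;>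
    simp [Fin.sum_univ_three, pauli, Matrix.trace_fin_two, Matrix.mul_apply, Fin.sum_univ_two, h] <;>
    ring_nf <;> simp only [Complex.I_sq] <;> ring

/-- The adjoint action on the Pauli matrices is the spin 1 representation. -/
theorem pauli_conj (U V : Matrix (Fin 2) (Fin 2) ℂ) (h : V * U = 1) (i : Fin 3) (A B : Fin 2) :
    ∑ j : Fin 3, ∑ C : Fin 2, pauli j A C * (2⁻¹ * (pauli i * V * pauli j * U).trace) * U C B =
      ∑ C : Fin 2, U A C * pauli i C B := by
  have ht : (U * pauli i * V).trace = 0 := by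
    rw [Matrix.trace_mul_cycle, h, Matrix.one_mul, pauli_trace]
  have hcyc (j : Fin 3) : (pauli i * V * pauli j * U).trace = (U * pauli i * V * pauli j).trace := by
    rw [Matrix.trace_mul_comm]
    simp only [Matrix.mul_assoc]
  rw [Finset.sum_comm]
  simp only [hcyc, ← Finset.sum_mul, pauli_expand _ ht]
  rw [← Matrix.mul_apply, ← Matrix.mul_apply, Matrix.mul_assoc, h, Matrix.mul_one]

end Pauli

variable {Pt : Type u} [Groupoid.{v} Pt]

/-- The additive group of states, a shortcut through the tensor product of `ℂ`-modules. -/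
noncomputable local instance : AddCommGroup (States Pt) :=
  TensorProduct.addCommGroup

section Holonomy

theorem Connection.hol_inv (A : Connection Pt) {x y : Pt} (e : x ⟶ y) :
    A.hol (Groupoid.inv e) = (A.hol e)⁻¹ := by
  have h1 : A.hol (𝟙 x) = 1 := by
    have := A.hol_comp (𝟙 x) (𝟙 x)
    rw [Category.comp_id] at this
    exact left_eq_mul.mp this
  have h2 := A.hol_comp e (Groupoid.inv e)
  rw [Groupoid.comp_inv, h1] at h2
  exact eq_inv_of_mul_eq_one_right h2.symm

/-- The evaluation of a cylindrical function at a connection. -/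
noncomputable def cylEval (A : Connection Pt) : Cyl Pt →ₐ[ℂ] ℂ :=
  (Pi.evalAlgHom ℂ (fun _ : Connection Pt => ℂ) A).comp (Cyl Pt).val

theorem cylEval_holMatrix {x y : Pt} (e : x ⟶ y) (B C : Fin 2) (A : Connection Pt) :
    cylEval A (holMatrix e B C) = (A.hol e : Matrix (Fin 2) (Fin 2) ℂ) B C := rfl

theorem cyl_ext {f g : Cyl Pt} (h : ∀ A, cylEval A f = cylEval A g) : f = g :=
  Subtype.ext (funext h)

theorem cylEval_holMatrix₁_inv {x y : Pt} (e : x ⟶ y) (i j : Fin 3) (A : Connection Pt) :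
    cylEval A (holMatrix₁ (Groupoid.inv e) i j) = 2⁻¹ * (pauli i *
      ((A.hol e)⁻¹ : SU2) * pauli j * (A.hol e : Matrix (Fin 2) (Fin 2) ℂ)).trace := by
  have hm (M : Matrix (Fin 2) (Fin 2) (Cyl Pt)) :
      cylEval A M.trace = (M.map (cylEval A)).trace := by
    simp [Matrix.trace]
  have hh {x y : Pt} (e : x ⟶ y) :
      (holMatrix e).map (cylEval A) = (A.hol e : Matrix (Fin 2) (Fin 2) ℂ) := rfl
  have hp (i : Fin 3) :
      ((pauli i).map (algebraMap ℂ (Cyl Pt))).map (cylEval A) = pauli i := by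
    ext a b
    simp
  rw [holMatrix₁, map_smul, hm, smul_eq_mul]
  simp only [Matrix.map_mul, hh, hp, A.hol_inv, inv_inv]

/-- The Pauli matrices are intertwiners between the spin 1 and the spin 1/2 holonomies. -/
theorem holMatrix₁_intertwine {x y : Pt} (e : x ⟶ y) (i : Fin 3) (A B : Fin 2) :
    ∑ j : Fin 3, ∑ C : Fin 2,
        pauli j A C • (holMatrix₁ (Groupoid.inv e) i j * holMatrix e C B) =
      ∑ C : Fin 2, pauli i C B • holMatrix e A C := by
  refine cyl_ext fun K => ?_
  have h := pauli_conj (K.hol e : Matrix (Fin 2) (Fin 2) ℂ) ((K.hol e)⁻¹ : SU2)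
    (by rw [← Submonoid.coe_mul, inv_mul_cancel]; rfl) i A B
  simp only [map_sum, map_smul, map_mul, cylEval_holMatrix, cylEval_holMatrix₁_inv, smul_eq_mul]
  simp only [← mul_assoc] at h ⊢
  rw [h]
  exact Finset.sum_congr rfl fun C _ => mul_comm _ _

end Holonomy

section Operators

theorem annihilate_create {Pt : Type u} (x y : Pt) (A B : Fin 2) (v : Fock Pt) [Decidable (y = x)] :
    annihilate x A (create y B v) =
      (if y = x ∧ B = A then (1 : ℂ) else 0) • v - create y B (annihilate x A v) := by
  have : ((LinearMap.proj A : (Fin 2 → ℂ) →ₗ[ℂ] ℂ) ∘ₗ Finsupp.lapply x)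
      (Finsupp.single y (Pi.single B (1 : ℂ))) = if y = x ∧ B = A then (1 : ℂ) else 0 := by
    by_cases h : y = x
    · subst h
      simp [Pi.single_apply, eq_comm]
    · simp [h]
  rw [← this]
  exact CliffordAlgebra.contractLeft_ι_mul (Q := (0 : QuadraticForm ℂ (OneParticle Pt))) _ _ _

theorem create_create {Pt : Type u} (x y : Pt) (A B : Fin 2) (v : Fock Pt) :
    create x A (create y B v) = - create y B (create x A v) := by
  have h := ExteriorAlgebra.ι_add_mul_swap (R := ℂ)
    (Finsupp.single x (Pi.single A (1 : ℂ)) : OneParticle Pt)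
    (Finsupp.single y (Pi.single B (1 : ℂ)))
  have h2 := congrArg (· * v) h
  simp only [add_mul, zero_mul, mul_assoc] at h2
  exact eq_neg_of_add_eq_zero_left h2

/-- The creation operators at `x` transform as a spinor under the spin at `x`. -/
theorem spinAt_mul_create {Pt : Type u} (x y : Pt) (i : Fin 3) (B : Fin 2) [Decidable (y = x)] :
    spinAt x i * create y B = create y B * spinAt x i +
      if y = x then (2⁻¹ : ℂ) • ∑ A : Fin 2, pauli i A B • create x A else 0 := by
  refine LinearMap.ext fun v => ?_
  have key (A A' : Fin 2) : create x A (annihilate x A' (create y B v)) =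
      create y B (create x A (annihilate x A' v)) +
        (if y = x ∧ B = A' then (1 : ℂ) else 0) • create x A v := by
    rw [annihilate_create, map_sub, map_smul, create_create x y]
    abel
  by_cases h : y = x
  · subst h
    simp only [spinAt, Module.End.mul_apply, LinearMap.add_apply, LinearMap.smul_apply,
      LinearMap.sum_apply, key, true_and, if_true, map_smul, map_sum, smul_add,
      Finset.sum_add_distrib]
    simp
  · simp only [spinAt, Module.End.mul_apply, LinearMap.add_apply, LinearMap.smul_apply,
      LinearMap.sum_apply, key, h, false_and, if_false, map_smul, map_sum]
    simp

theorem act_mul (f g : Cyl Pt) (T U : Module.End ℂ (Fock Pt)) :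
    act f T * act g U = act (f * g) (T * U) := by
  refine TensorProduct.ext' fun a b => ?_
  simp [act]

/-- `act` as a bilinear map. -/
noncomputable def actBilin :
    Cyl Pt →ₗ[ℂ] Module.End ℂ (Fock Pt) →ₗ[ℂ] Module.End ℂ (States Pt) :=
  (TensorProduct.mapBilinear (RingHom.id ℂ) (Cyl Pt) (Fock Pt) (Cyl Pt) (Fock Pt)).comp
    (LinearMap.mul ℂ (Cyl Pt))

theorem act_eq_actBilin (f : Cyl Pt) (T : Module.End ℂ (Fock Pt)) :
    act f T = actBilin f T := rfl

theorem act_cyl_smul (f g : Cyl Pt) (T : Module.End ℂ (Fock Pt)) (ψ : States Pt) :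
    act f T (g • ψ) = g • act f T ψ := by
  induction ψ using TensorProduct.induction_on with
  | zero => simp
  | tmul a b => simp [act, TensorProduct.smul_tmul', mul_left_comm]
  | add x y hx hy => rw [smul_add, map_add, hx, hy, map_add, smul_add]

open Classical in
/-- The spin transported along an edge acts on the transported spinor index by Pauli matrices, and it
commutes with the creation operators of the other edges, as their sources are different. -/
theorem transportedSpin_mul_dressedCreate {n : ℕ} (E : EdgeSet Pt n) (a b : Fin n) (i : Fin 3)
    (A : Fin 2) :
    transportedSpin (E.edge a) i * dressedCreate (E.edge b) A =
      dressedCreate (E.edge b) A * transportedSpin (E.edge a) i +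
        if b = a then (2⁻¹ : ℂ) • ∑ B : Fin 2, pauli i B A • dressedCreate (E.edge b) B else 0 := by
  have key : transportedSpin (E.edge a) i * dressedCreate (E.edge b) A =
      dressedCreate (E.edge b) A * transportedSpin (E.edge a) i +
        ∑ j, ∑ B, act (holMatrix₁ (Groupoid.inv (E.edge a)) i j * holMatrix (E.edge b) B A)
          (if E.source b = E.source a then
            (2⁻¹ : ℂ) • ∑ C : Fin 2, pauli j C B • create (E.source a) C else 0) := by
    simp only [transportedSpin, dressedCreate, Finset.sum_mul_sum, act_mul, spinAt_mul_create]
    rw [Finset.sum_comm (γ := Fin 2)]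
    simp only [← Finset.sum_add_distrib]
    refine Finset.sum_congr rfl fun B _ => Finset.sum_congr rfl fun j _ => ?_
    rw [act_eq_actBilin, map_add, mul_comm (holMatrix (E.edge b) _ _)]
    rfl
  rw [key]
  congr 1
  by_cases h : b = a
  · subst h
    simp only [if_true, dressedCreate]
    have := congrArg (fun f : Fin 2 → Cyl Pt => ∑ C, actBilin (f C) (create (E.source b) C))
      (funext fun C => holMatrix₁_intertwine (E.edge b) i C A)
    simp only [act_eq_actBilin, map_sum, map_smul, LinearMap.sum_apply, LinearMap.smul_apply] at this ⊢
    simp only [Finset.smul_sum] at this ⊢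
    have h2 := congrArg ((2⁻¹ : ℂ) • ·) this
    simp only [Finset.smul_sum] at h2
    rw [Finset.sum_comm (γ := Fin 2)]
    rw [Finset.sum_comm] at h2
    rw [Finset.sum_comm (γ := Fin 2)]
    refine Eq.trans ?_ (h2.trans ?_)
    · refine Finset.sum_congr rfl fun j _ => ?_
      rw [Finset.sum_comm]
    · rw [Finset.sum_comm]
  · rw [if_neg h]
    simp [mt (fun h => E.source_injective h) h, act_eq_actBilin]

theorem totalSpin_mul_dressedCreate {n : ℕ} (E : EdgeSet Pt n) (b : Fin n) (i : Fin 3)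
    (A : Fin 2) :
    totalSpin E i * dressedCreate (E.edge b) A = dressedCreate (E.edge b) A * totalSpin E i +
      ∑ B : Fin 2, (2⁻¹ * pauli i B A) • dressedCreate (E.edge b) B := by
  classical
  simp only [totalSpin, Finset.sum_mul, Finset.mul_sum, transportedSpin_mul_dressedCreate,
    Finset.sum_add_distrib, Finset.sum_ite_eq, Finset.mem_univ, if_true, Finset.smul_sum, smul_smul]

theorem totalSpin_vacuum {n : ℕ} (E : EdgeSet Pt n) (i : Fin 3) :
    totalSpin E i (1 ⊗ₜ[ℂ] 1) = 0 := by
  have (x : Pt) (j : Fin 3) : spinAt x j (1 : Fock Pt) = 0 := by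
    have (A : Fin 2) : annihilate x A (1 : Fock Pt) = 0 :=
      CliffordAlgebra.contractLeft_one (Q := (0 : QuadraticForm ℂ (OneParticle Pt))) _
    simp [spinAt, this]
  simp [totalSpin, transportedSpin, act, this]

/-- The Leibniz rule for an operator whose commutators with the factors of a product are linear in
the factors. -/
theorem derivation_prod_ofFn {V : Type*} [AddCommMonoid V] [Module ℂ V] (T : Module.End ℂ V)
    (c : Fin 2 → Fin 2 → ℂ) {n : ℕ} (d : Fin n → Fin 2 → Module.End ℂ V)
    (h : ∀ a A, T * d a A = d a A * T + ∑ B, c B A • d a B) (C : Fin n → Fin 2) (v : V) :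
    T ((List.ofFn fun a => d a (C a)).prod v) = (List.ofFn fun a => d a (C a)).prod (T v) +
      ∑ a, ∑ B, c B (C a) •
        (List.ofFn fun b => d b (Function.update C a B b)).prod v := by
  induction n with
  | zero => simp
  | succ n ih =>
    have h0 := fun w => LinearMap.congr_fun (h 0 (C 0)) w
    simp only [Module.End.mul_apply, LinearMap.add_apply, LinearMap.sum_apply,
      LinearMap.smul_apply] at h0
    have hu (a : Fin n) (B : Fin 2) (b : Fin n) :
        Function.update C a.succ B b.succ = Function.update (fun x : Fin n => C x.succ) a B b := by
      simp [Function.update_apply]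
    simp only [List.ofFn_succ, List.prod_cons, Module.End.mul_apply, h0,
      ih (fun a => d a.succ) (fun a => h a.succ) fun a => C a.succ, map_add, map_sum, map_smul,
      Fin.sum_univ_succ (n := n), Function.update_self, hu, ne_eq, Fin.succ_ne_zero,
      not_false_eq_true, Function.update_of_ne, (Fin.succ_ne_zero _).symm]
    abel

theorem totalSpin_basicState {n : ℕ} (E : EdgeSet Pt n) (i : Fin 3) (C : Fin n → Fin 2) :
    totalSpin E i (basicState E C) =
      ∑ a, ∑ B, (2⁻¹ * pauli i B (C a)) • basicState E (Function.update C a B) := by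
  have := derivation_prod_ofFn (totalSpin E i) (fun B A => 2⁻¹ * pauli i B A)
    (fun a A => dressedCreate (E.edge a) A) (fun a A => totalSpin_mul_dressedCreate E a i A) C
    (1 ⊗ₜ[ℂ] 1)
  rwa [totalSpin_vacuum, map_zero, zero_add] at this

/-- The squared total spin permutes the spinor indices of the fermions, since
`∑ᵢ σᵢ ⊗ σᵢ = 2 swap - 1`. -/
theorem totalSpinSq_basicState {n : ℕ} (E : EdgeSet Pt n) (C : Fin n → Fin 2) :
    totalSpinSq E (basicState E C) = ((n : ℂ) / 2 - (n : ℂ) ^ 2 / 4) • basicState E C +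
      ∑ a, ∑ b, (2⁻¹ : ℂ) • basicState E (C ∘ Equiv.swap a b) := by
  have pair (a b : Fin n) :
      ∑ i : Fin 3, ∑ B, ∑ B', ((2⁻¹ * pauli i B (C a)) *
        (2⁻¹ * pauli i B' (Function.update C a B b))) •
          basicState E (Function.update (Function.update C a B) b B') =
      (2⁻¹ : ℂ) • basicState E (C ∘ Equiv.swap a b) - (4⁻¹ : ℂ) • basicState E C +
        if a = b then (2⁻¹ : ℂ) • basicState E C else 0 := by
    have hc (B B' X : Fin 2) : ∑ i : Fin 3, (2⁻¹ * pauli i B (C a)) * (2⁻¹ * pauli i B' X) =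
        4⁻¹ * (2 * ((if B = X then 1 else 0) * (if B' = C a then 1 else 0)) -
        (if B = C a then 1 else 0) * (if B' = X then 1 else 0)) := by
      rw [← pauli_fierz, Finset.mul_sum]
      exact Finset.sum_congr rfl fun i _ => by ring
    rw [Finset.sum_comm, Finset.sum_congr rfl fun B _ => Finset.sum_comm]
    simp_rw [← Finset.sum_smul, hc]
    by_cases hab : a = b
    · subst hab
      simp only [Function.update_self, Function.update_idem, Equiv.swap_self, if_true]
      have hC : C ∘ (Equiv.refl (Fin n)) = C := rfl
      rw [hC, Finset.sum_comm]
      have hs (y : Fin 2) : ∑ x : Fin 2, (4⁻¹ * (2 * (1 *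
          (if y = C a then 1 else 0)) - (if x = C a then 1 else 0) * (if y = x then 1 else 0)) : ℂ) =
          4⁻¹ * (4 * (if y = C a then 1 else 0) - (if y = C a then 1 else 0)) := by
        generalize C a = z
        fin_cases y <;> fin_cases z <;> simp [Fin.sum_univ_two] <;> norm_num
      simp only [← Finset.sum_smul, hs]
      have : ∀ y : Fin 2, (4⁻¹ * (4 * (if y = C a then 1 else 0) - (if y = C a then 1 else 0)) : ℂ) •
          basicState E (Function.update C a y) =
          if y = C a then (3 / 4 : ℂ) • basicState E C else 0 := by
        intro y
        split_ifs with h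
        · rw [h, Function.update_eq_self]
          norm_num
        · simp
      rw [Finset.sum_congr rfl fun y _ => this y]
      simp only [Finset.sum_ite_eq', Finset.mem_univ, if_true]
      rw [← sub_smul, ← add_smul]
      norm_num
    · have hsw : Function.update (Function.update C a (C b)) b (C a) = C ∘ Equiv.swap a b := by
        funext x
        simp only [Function.update_apply, Function.comp, Equiv.swap_apply_def]
        split_ifs <;> simp_all
      have hid : Function.update (Function.update C a (C a)) b (C b) = C := by simp
      simp only [Function.update_of_ne (Ne.symm hab), if_neg hab, add_zero, mul_sub, sub_smul,
        Finset.sum_sub_distrib]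
      congr 1
      · rw [← hsw, Finset.sum_eq_single (C b), Finset.sum_eq_single (C a)]
        · norm_num
        · intro B' _ h; simp [h]
        · simp
        · intro B _ h; simp [h]
        · simp
      · rw [Finset.sum_eq_single (C a), Finset.sum_eq_single (C b)]
        · simp
        · intro B' _ h; simp [h]
        · simp
        · intro B _ h; simp [h]
        · simp
  have expand : totalSpinSq E (basicState E C) = ∑ a, ∑ b, ∑ i : Fin 3, ∑ B, ∑ B',
      ((2⁻¹ * pauli i B (C a)) * (2⁻¹ * pauli i B' (Function.update C a B b))) •
          basicState E (Function.update (Function.update C a B) b B') := by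
    simp only [totalSpinSq, LinearMap.sum_apply, Module.End.mul_apply, totalSpin_basicState,
      map_sum, map_smul, Finset.smul_sum, smul_smul]
    rw [Finset.sum_comm]
    refine Finset.sum_congr rfl fun a _ => ?_
    rw [Finset.sum_comm (γ := Fin n)]
    refine Finset.sum_congr rfl fun i _ => ?_
    rw [Finset.sum_comm]
  rw [expand]
  simp_rw [pair, Finset.sum_add_distrib, Finset.sum_sub_distrib]
  simp only [Finset.sum_ite_eq, Finset.mem_univ, if_true, Finset.sum_const, Finset.card_univ,
    Fintype.card_fin, ← Nat.cast_smul_eq_nsmul ℂ, smul_smul]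
  module

theorem totalSpinSq_cyl_smul {n : ℕ} (E : EdgeSet Pt n) (f : Cyl Pt) (ψ : States Pt) :
    totalSpinSq E (f • ψ) = f • totalSpinSq E ψ := by
  have h (i : Fin 3) (ψ : States Pt) : totalSpin E i (f • ψ) = f • totalSpin E i ψ := by
    simp only [totalSpin, transportedSpin, LinearMap.sum_apply, act_cyl_smul, Finset.smul_sum]
  simp only [totalSpinSq, LinearMap.sum_apply, Module.End.mul_apply, h, Finset.smul_sum]

/-- The squared total spin, on the coefficients with respect to the basic states. -/
theorem totalSpinSq_sum_smul {n : ℕ} (E : EdgeSet Pt n) (f : (Fin n → Fin 2) → Cyl Pt) :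
    totalSpinSq E (∑ C, f C • basicState E C) =
      ∑ C, (((n : ℂ) / 2 - (n : ℂ) ^ 2 / 4) • f C +
        (2⁻¹ : ℂ) • ∑ a, ∑ b, f (C ∘ Equiv.swap a b)) • basicState E C := by
  have h (a b : Fin n) : ∑ C, f C • basicState E (C ∘ Equiv.swap a b) =
      ∑ C, f (C ∘ Equiv.swap a b) • basicState E C := by
    refine Fintype.sum_equiv ((Equiv.swap a b).arrowCongr (Equiv.refl (Fin 2))) _ _ fun C => ?_
    have : (C ∘ Equiv.swap a b) ∘ Equiv.swap a b = C := by
      funext x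
      simp
    change _ = f ((C ∘ Equiv.swap a b) ∘ Equiv.swap a b) • basicState E (C ∘ Equiv.swap a b)
    rw [this]
  simp only [map_sum, totalSpinSq_cyl_smul, totalSpinSq_basicState, smul_add, Finset.smul_sum,
    add_smul, Finset.sum_add_distrib, Finset.sum_smul]
  congr 1
  · refine Finset.sum_congr rfl fun C _ => ?_
    rw [smul_comm, smul_assoc]
  · rw [Finset.sum_comm]
    conv_rhs => rw [Finset.sum_comm]
    refine Finset.sum_congr rfl fun a _ => ?_
    rw [Finset.sum_comm]
    conv_rhs => rw [Finset.sum_comm]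
    refine Finset.sum_congr rfl fun b _ => ?_
    rw [Finset.sum_congr rfl fun C _ => smul_comm (f C) (2⁻¹ : ℂ) _, ← Finset.smul_sum, h,
      Finset.smul_sum]
    exact Finset.sum_congr rfl fun C _ => (smul_assoc _ _ _).symm

end Operators

/-! ### Weights of diagrams -/

section Weight

variable {n twok twoj : ℕ} {R : Type*} [CommRing R] [Algebra ℂ R]

/-- The coefficient of a diagram at the spinor indices `C` of the fermions and `A` of the outflowing
lines, where the outflowing line `s` carries the matrix `H s`. -/
noncomputable def Diagram.weight (H : Outflow twok twoj → Matrix (Fin 2) (Fin 2) R)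
    (D : Diagram n twok twoj)
    (A : Outflow twok twoj → Fin 2) (C : Fin n → Fin 2) : R :=
  (D.legs.map fun l => H l.2 (C l.1) (A l.2)).prod *
    (D.links.map fun l => algebraMap ℂ R (binor (C l.1) (C l.2))).prod *
    (D.holonomies.map fun l => ∑ F : Fin 2, ∑ G : Fin 2,
      algebraMap ℂ R (binor F G) * H l.1 F (A l.1) * H l.2 G (A l.2)).prod

/-- The fermions of a diagram, in the order of its list of lines. -/
def Diagram.fermions (D : Diagram n twok twoj) : List (Fin n) :=
  D.legs.map Prod.fst ++ (D.links.map Prod.fst ++ D.links.map Prod.snd)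

/-- The outflowing lines of a diagram, in the order of its list of lines. -/
def Diagram.outflow (D : Diagram n twok twoj) : List (Outflow twok twoj) :=
  D.legs.map Prod.snd ++ (D.holonomies.map Prod.fst ++ D.holonomies.map Prod.snd)

/-- The diagrams that occur as reductions of block products: each fermion occurs once, each
outflowing line at most once, and the type of a fermion on a leg determines the point of outflow
of the leg. -/
structure Diagram.IsProper (τ : Fin n → FermionType) (D : Diagram n twok twoj) : Prop where
  fermions_nodup : D.fermions.Nodup
  fermions_mem : ∀ a, a ∈ D.fermions
  outflow_nodup : D.outflow.Nodup
  top_type : ∀ a i, (a, Sum.inl i) ∈ D.legs → τ a = FermionType.reducing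
  bot_type : ∀ a i, (a, Sum.inr i) ∈ D.legs → τ a = FermionType.increasing

theorem Diagram.IsBlockProduct.isProper {τ : Fin n → FermionType} {D : Diagram n twok twoj}
    (h : D.IsBlockProduct τ) : D.IsProper τ where
  fermions_nodup := h.fermions_nodup
  fermions_mem := h.fermions_mem
  outflow_nodup := by simpa [Diagram.outflow, h.holonomies_eq] using h.outflow_nodup
  top_type := h.top_type
  bot_type := h.bot_type

theorem Diagram.IsBlockProduct.length_legs {τ : Fin n → FermionType} {D : Diagram n twok twoj}
    (h : D.IsBlockProduct τ) : D.legs.length = twok + twoj := by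
  classical
  have h1 : (D.legs.map Prod.snd).toFinset = Finset.univ := by
    ext s
    simpa using h.outflow_mem s
  have h2 := List.toFinset_card_of_nodup h.outflow_nodup
  rw [h1, List.length_map, Finset.card_univ, Fintype.card_sum, Fintype.card_fin,
    Fintype.card_fin] at h2
  exact h2.symm

theorem Diagram.weight_perm {H : Outflow twok twoj → Matrix (Fin 2) (Fin 2) R}
    {D D' : Diagram n twok twoj} (h1 : D.legs.Perm D'.legs) (h2 : D.links.Perm D'.links)
    (h3 : D.holonomies.Perm D'.holonomies) (A : Outflow twok twoj → Fin 2) (C : Fin n → Fin 2) :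
    D.weight H A C = D'.weight H A C := by
  rw [weight, weight, (h1.map _).prod_eq, (h2.map _).prod_eq, (h3.map _).prod_eq]

theorem Diagram.weight_congr {H : Outflow twok twoj → Matrix (Fin 2) (Fin 2) R}
    (D : Diagram n twok twoj) {A A' : Outflow twok twoj → Fin 2} {C C' : Fin n → Fin 2}
    (hA : ∀ s ∈ D.outflow, A s = A' s) (hC : ∀ a ∈ D.fermions, C a = C' a) :
    D.weight H A C = D.weight H A' C' := by
  simp only [outflow, fermions, List.mem_append, List.mem_map] at hA hC
  unfold weight
  congr 1
  · congr 1
    · refine congrArg _ (List.map_congr_left fun l hl => ?_)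
      rw [hA l.2 (Or.inl ⟨l, hl, rfl⟩), hC l.1 (Or.inl ⟨l, hl, rfl⟩)]
    · refine congrArg _ (List.map_congr_left fun l hl => ?_)
      rw [hC l.1 (Or.inr (Or.inl ⟨l, hl, rfl⟩)), hC l.2 (Or.inr (Or.inr ⟨l, hl, rfl⟩))]
  · refine congrArg _ (List.map_congr_left fun l hl => ?_)
    rw [hA l.1 (Or.inr (Or.inl ⟨l, hl, rfl⟩)), hA l.2 (Or.inr (Or.inr ⟨l, hl, rfl⟩))]

theorem Diagram.weight_cons_leg {H : Outflow twok twoj → Matrix (Fin 2) (Fin 2) R}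
    (l : Fin n × Outflow twok twoj) (L : List (Fin n × Outflow twok twoj))
    (K : List (Fin n × Fin n)) (J : List (Outflow twok twoj × Outflow twok twoj))
    (A : Outflow twok twoj → Fin 2) (C : Fin n → Fin 2) :
    weight H ⟨l :: L, K, J⟩ A C = H l.2 (C l.1) (A l.2) * weight H ⟨L, K, J⟩ A C := by
  simp only [weight, List.map_cons, List.prod_cons]
  ring

theorem Diagram.weight_cons_link {H : Outflow twok twoj → Matrix (Fin 2) (Fin 2) R}
    (L : List (Fin n × Outflow twok twoj)) (l : Fin n × Fin n)
    (K : List (Fin n × Fin n)) (J : List (Outflow twok twoj × Outflow twok twoj))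
    (A : Outflow twok twoj → Fin 2) (C : Fin n → Fin 2) :
    weight H ⟨L, l :: K, J⟩ A C =
      algebraMap ℂ R (binor (C l.1) (C l.2)) * weight H ⟨L, K, J⟩ A C := by
  simp only [weight, List.map_cons, List.prod_cons]
  ring

theorem Diagram.weight_cons_holonomy {H : Outflow twok twoj → Matrix (Fin 2) (Fin 2) R}
    (L : List (Fin n × Outflow twok twoj)) (K : List (Fin n × Fin n))
    (l : Outflow twok twoj × Outflow twok twoj) (J : List (Outflow twok twoj × Outflow twok twoj))
    (A : Outflow twok twoj → Fin 2) (C : Fin n → Fin 2) :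
    weight H ⟨L, K, l :: J⟩ A C =
      (∑ F : Fin 2, ∑ G : Fin 2,
        algebraMap ℂ R (binor F G) * H l.1 F (A l.1) * H l.2 G (A l.2)) *
        weight H ⟨L, K, J⟩ A C := by
  simp only [weight, List.map_cons, List.prod_cons]
  ring

variable {τ : Fin n → FermionType} {D : Diagram n twok twoj}

@[to_additive]
theorem Diagram.IsProper.prod_fermions (h : D.IsProper τ) {M : Type*} [CommMonoid M]
    (g : Fin n → M) :
    ∏ a, g a = (D.legs.map fun l => g l.1).prod * (D.links.map fun l => g l.1 * g l.2).prod := by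
  have h1 : D.fermions.toFinset = Finset.univ := by
    ext s
    simpa using h.fermions_mem s
  rw [← h1, List.prod_toFinset _ h.fermions_nodup, fermions, List.map_append, List.map_append,
    List.prod_append, List.prod_append, List.map_map, List.map_map, List.map_map,
    ← List.prod_map_mul]
  rfl

theorem Diagram.IsProper.card_fermions (h : D.IsProper τ) :
    n = D.legs.length + 2 * D.links.length := by
  have := h.sum_fermions (fun _ => 1)
  simpa [mul_comm] using this

/-- The singlet identity: an antisymmetrised pair of spinor indices drops out. -/
theorem binor_exchange (g : Fin 2 → R) (a b y : Fin 2) :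
    algebraMap ℂ R (binor y b) * g a + algebraMap ℂ R (binor a y) * g b =
      algebraMap ℂ R (binor a b) * g y := by
  fin_cases a <;> fin_cases b <;> fin_cases y <;> simp [binor]

/-- The two fermions of a link form a singlet: exchanging either of them with a third fermion gives
back the diagram in total. -/
theorem Diagram.IsProper.weight_swap_link (h : D.IsProper τ)
    (H : Outflow twok twoj → Matrix (Fin 2) (Fin 2) R) (A : Outflow twok twoj → Fin 2)
    (C : Fin n → Fin 2) {l : Fin n × Fin n} (hl : l ∈ D.links) (y : Fin n) :
    D.weight H A (C ∘ Equiv.swap l.1 y) + D.weight H A (C ∘ Equiv.swap l.2 y) =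
      D.weight H A C - (if y = l.1 then D.weight H A C else 0) -
        (if y = l.2 then D.weight H A C else 0) := by
  obtain ⟨K, hK⟩ : ∃ K, D.links.Perm (l :: K) := ⟨_, List.perm_cons_erase hl⟩
  set D' : Diagram n twok twoj := ⟨D.legs, K, D.holonomies⟩
  have hw (C : Fin n → Fin 2) : D.weight H A C =
      algebraMap ℂ R (binor (C l.1) (C l.2)) * D'.weight H A C := by
    rw [← weight_cons_link]
    exact weight_perm (D := D) (D' := ⟨D.legs, l :: K, D.holonomies⟩) (List.Perm.refl _) hK
      (List.Perm.refl _) A C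
  have hp : D.fermions.Perm (l.1 :: l.2 :: D'.fermions) := by
    unfold fermions
    refine (((hK.map Prod.fst).append (hK.map Prod.snd)).append_left _).trans ?_
    simp only [List.map_cons, List.cons_append]
    refine List.perm_middle.trans (List.Perm.cons _ ?_)
    rw [← List.append_assoc]
    refine List.perm_middle.trans (List.Perm.cons _ ?_)
    rw [List.append_assoc]
  have hnd := hp.nodup_iff.mp h.fermions_nodup
  simp only [List.nodup_cons, List.mem_cons, not_or] at hnd
  obtain ⟨⟨h12, h1⟩, h2, -⟩ := hnd
  have hc {C C' : Fin n → Fin 2} (hC : ∀ x, x ≠ l.1 → x ≠ l.2 → C x = C' x) :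
      D'.weight H A C = D'.weight H A C' := by
    refine weight_congr _ (fun _ _ => rfl) fun x hx => hC x ?_ ?_
    · rintro rfl; exact h1 hx
    · rintro rfl; exact h2 hx
  have hanti (a b : Fin 2) : algebraMap ℂ R (binor a b) = - algebraMap ℂ R (binor b a) := by
    fin_cases a <;> fin_cases b <;> simp [binor]
  have hsw : D.weight H A (C ∘ Equiv.swap l.1 l.2) = - D.weight H A C := by
    rw [hw, hw C, hc (C := C ∘ Equiv.swap l.1 l.2) (C' := C)]
    · simp only [Function.comp, Equiv.swap_apply_left, Equiv.swap_apply_right]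
      rw [hanti]
      ring
    · intro x hx1 hx2
      simp [Equiv.swap_apply_of_ne_of_ne hx1 hx2]
  have hid (a : Fin n) : C ∘ Equiv.swap a a = C := by simp
  by_cases hy1 : y = l.1
  · rw [hy1, hid, Equiv.swap_comm, hsw, if_pos rfl, if_neg h12]
    ring
  by_cases hy2 : y = l.2
  · rw [hy2, hid, hsw, if_pos rfl, if_neg (Ne.symm h12)]
    ring
  rw [if_neg hy1, if_neg hy2, sub_zero, sub_zero]
  have e1 : D'.weight H A (C ∘ Equiv.swap l.1 y) =
      D'.weight H A (Function.update C y (C l.1)) := by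
    refine hc fun x hx1 _ => ?_
    by_cases hxy : x = y
    · subst hxy; simp
    · simp [hxy, Equiv.swap_apply_of_ne_of_ne hx1 hxy]
  have e2 : D'.weight H A (C ∘ Equiv.swap l.2 y) =
      D'.weight H A (Function.update C y (C l.2)) := by
    refine hc fun x _ hx2 => ?_
    by_cases hxy : x = y
    · subst hxy; simp
    · simp [hxy, Equiv.swap_apply_of_ne_of_ne hx2 hxy]
  have := binor_exchange (fun z => D'.weight H A (Function.update C y z)) (C l.1) (C l.2) (C y)
  rw [Function.update_eq_self] at this
  rw [hw, hw, hw C, e1, e2, ← this]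
  simp only [Function.comp, Equiv.swap_apply_left,
    Equiv.swap_apply_of_ne_of_ne h12 (Ne.symm hy1),
    Equiv.swap_apply_of_ne_of_ne (Ne.symm h12) (Ne.symm hy2)]

/-- The exchange operator summed over all pairs of fermions, with the pairs that involve a
singlet carried out. -/
theorem Diagram.IsProper.sum_weight_swap (h : D.IsProper τ)
    (H : Outflow twok twoj → Matrix (Fin 2) (Fin 2) R) (A : Outflow twok twoj → Fin 2)
    (C : Fin n → Fin 2) :
    ∑ a, ∑ b, D.weight H A (C ∘ Equiv.swap a b) =
      (D.legs.map fun l => (D.legs.map fun l' =>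
        D.weight H A (C ∘ Equiv.swap l.1 l'.1)).sum).sum +
      ((D.links.length : ℂ) * ((n : ℂ) - 2 + D.legs.length)) • D.weight H A C := by
  have hlink : ∀ l ∈ D.links, ∑ b, D.weight H A (C ∘ Equiv.swap l.1 b) +
      ∑ b, D.weight H A (C ∘ Equiv.swap l.2 b) = ((n : ℂ) - 2) • D.weight H A C := by
    intro l hl
    rw [← Finset.sum_add_distrib, Finset.sum_congr rfl fun y _ => h.weight_swap_link H A C hl y]
    simp only [Finset.sum_sub_distrib, Finset.sum_ite_eq', Finset.mem_univ, if_true,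
      Finset.sum_const, Finset.card_univ, Fintype.card_fin, ← Nat.cast_smul_eq_nsmul ℂ]
    module
  have hleg : ∀ l ∈ D.legs, ∑ b, D.weight H A (C ∘ Equiv.swap l.1 b) =
      (D.legs.map fun l' => D.weight H A (C ∘ Equiv.swap l.1 l'.1)).sum +
        (D.links.length : ℂ) • D.weight H A C := by
    intro l hl
    rw [h.sum_fermions]
    congr 1
    have : ∀ l' ∈ D.links, D.weight H A (C ∘ Equiv.swap l.1 l'.1) +
        D.weight H A (C ∘ Equiv.swap l.1 l'.2) = D.weight H A C := by
      intro l' hl'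
      rw [Equiv.swap_comm, Equiv.swap_comm l.1, h.weight_swap_link H A C hl']
      have hnd := h.fermions_nodup
      rw [fermions, List.nodup_append] at hnd
      have hne := fun x hx => hnd.2.2 l.1 (List.mem_map_of_mem hl) x hx
      rw [if_neg (hne _ (List.mem_append_left _ (List.mem_map_of_mem hl'))),
        if_neg (hne _ (List.mem_append_right _ (List.mem_map_of_mem hl'))), sub_zero, sub_zero]
    rw [List.map_congr_left this]
    simp [← Nat.cast_smul_eq_nsmul ℂ]
  rw [h.sum_fermions, List.map_congr_left hlink, List.map_congr_left hleg, List.sum_map_add]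
  simp only [List.map_const', List.sum_replicate, ← Nat.cast_smul_eq_nsmul ℂ]
  module

end Weight

section Reduce

variable {n twok twoj : ℕ} {τ : Fin n → FermionType} {D D' : Diagram n twok twoj}

/-- The reduction by two fermions on legs exists; the remaining legs are `L`. -/
theorem Diagram.reduce_of_mem (hD : (D.legs.map Prod.fst).Nodup) {a b : Fin n}
    {s t : Outflow twok twoj} (ha : (a, s) ∈ D.legs) (hb : (b, t) ∈ D.legs) (hab : a ≠ b) :
    ∃ L, D.reduce (a, b) = some ⟨L, (a, b) :: D.links, (s, t) :: D.holonomies⟩ ∧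
      D.legs.Perm ((a, s) :: (b, t) :: L) := by
  have find {a : Fin n} {s : Outflow twok twoj} (ha : (a, s) ∈ D.legs) :
      D.legs.find? (fun l => l.1 = a) = some (a, s) := by
    cases hf : D.legs.find? (fun l => l.1 = a) with
    | none =>
      rw [List.find?_eq_none] at hf
      exact absurd (hf _ ha) (by simp)
    | some l =>
      have h1 := List.find?_some hf
      have h2 := List.mem_of_find?_eq_some hf
      rw [List.inj_on_of_nodup_map hD h2 ha (by simpa using h1)]
  refine ⟨D.legs.filter fun m => m.1 ≠ a ∧ m.1 ≠ b, ?_, ?_⟩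
  · simp only [reduce, find ha, find hb]
  · have hL : D.legs.Nodup := List.Nodup.of_map _ hD
    rw [List.perm_ext_iff_of_nodup hL]
    · intro l
      simp only [List.mem_cons, List.mem_filter, decide_eq_true_eq]
      constructor
      · intro hl
        by_cases h1 : l.1 = a
        · exact Or.inl (List.inj_on_of_nodup_map hD hl ha h1)
        by_cases h2 : l.1 = b
        · exact Or.inr (Or.inl (List.inj_on_of_nodup_map hD hl hb h2))
        exact Or.inr (Or.inr ⟨hl, h1, h2⟩)
      · rintro (rfl | rfl | ⟨hl, -⟩)
        · exact ha
        · exact hb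
        · exact hl
    · simp only [List.nodup_cons, List.mem_cons, List.mem_filter, decide_eq_true_eq]
      refine ⟨?_, ?_, hL.filter _⟩
      · rintro (h | ⟨-, h, -⟩)
        · exact hab (congrArg Prod.fst h)
        · exact h rfl
      · rintro ⟨-, -, h⟩
        exact h rfl

theorem Diagram.mem_of_reduce_eq_some {c : Fin n × Fin n} (h : D.reduce c = some D') :
    (∃ s, (c.1, s) ∈ D.legs) ∧ ∃ t, (c.2, t) ∈ D.legs := by
  unfold reduce at h
  split at h
  · rename_i l l' h1 h2
    refine ⟨⟨l.2, ?_⟩, ⟨l'.2, ?_⟩⟩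
    · have := List.find?_some h1
      simp only [decide_eq_true_eq] at this
      rw [← this]
      exact List.mem_of_find?_eq_some h1
    · have := List.find?_some h2
      simp only [decide_eq_true_eq] at this
      rw [← this]
      exact List.mem_of_find?_eq_some h2
  · exact absurd h (by simp)

theorem Diagram.IsProper.legs_nodup (h : D.IsProper τ) : (D.legs.map Prod.fst).Nodup :=
  (List.nodup_append.mp h.fermions_nodup).1

theorem Diagram.IsProper.exists_of_reduce (h : D.IsProper τ) {c : Fin n × Fin n}
    (hc : c.1 ≠ c.2) (hr : D.reduce c = some D') :
    ∃ s t L, D' = ⟨L, c :: D.links, (s, t) :: D.holonomies⟩ ∧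
      D.legs.Perm ((c.1, s) :: (c.2, t) :: L) := by
  obtain ⟨⟨s, hs⟩, t, ht⟩ := mem_of_reduce_eq_some hr
  obtain ⟨L, hL, hp⟩ := reduce_of_mem h.legs_nodup hs ht hc
  rw [hr] at hL
  exact ⟨s, t, L, Option.some.inj hL, hp⟩

theorem Diagram.IsProper.reduce (h : D.IsProper τ) {c : Fin n × Fin n} (hc : c.1 ≠ c.2)
    (hr : D.reduce c = some D') : D'.IsProper τ := by
  obtain ⟨s, t, L, rfl, hp⟩ := h.exists_of_reduce hc hr
  have hf : D.fermions.Perm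
      (Diagram.fermions (⟨L, c :: D.links, (s, t) :: D.holonomies⟩ : Diagram n twok twoj)) := by
    unfold fermions
    refine ((hp.map Prod.fst).append_right _).trans ?_
    simp only [List.map_cons, List.cons_append]
    refine List.Perm.trans ?_ List.perm_middle.symm
    refine List.Perm.cons _ ?_
    rw [← List.append_assoc, ← List.append_assoc]
    exact List.perm_middle.symm
  have ho : D.outflow.Perm
      (Diagram.outflow (⟨L, c :: D.links, (s, t) :: D.holonomies⟩ : Diagram n twok twoj)) := by
    unfold outflow
    refine ((hp.map Prod.snd).append_right _).trans ?_
    simp only [List.map_cons, List.cons_append]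
    refine List.Perm.trans ?_ List.perm_middle.symm
    refine List.Perm.cons _ ?_
    rw [← List.append_assoc, ← List.append_assoc]
    exact List.perm_middle.symm
  exact
  { fermions_nodup := hf.nodup_iff.mp h.fermions_nodup
    fermions_mem := fun a => hf.mem_iff.mp (h.fermions_mem a)
    outflow_nodup := ho.nodup_iff.mp h.outflow_nodup
    top_type := fun a i hl => h.top_type a i
      (hp.mem_iff.mpr (List.mem_cons_of_mem _ (List.mem_cons_of_mem _ hl)))
    bot_type := fun a i hl => h.bot_type a i
      (hp.mem_iff.mpr (List.mem_cons_of_mem _ (List.mem_cons_of_mem _ hl))) }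

/-- Each reduction removes two legs and adds a pure holonomy. -/
theorem Diagram.IsProper.reduceAll (h : D.IsProper τ) {cs : List (Fin n × Fin n)}
    (hc : ∀ c ∈ cs, c.1 ≠ c.2) (hr : D.reduceAll cs = some D') :
    D'.IsProper τ ∧ D.legs.length = D'.legs.length + 2 * cs.length ∧
      D'.holonomies.length = D.holonomies.length + cs.length := by
  induction cs generalizing D with
  | nil =>
    obtain rfl : D = D' := by simpa [Diagram.reduceAll] using hr
    exact ⟨h, by simp, by simp⟩
  | cons c cs ih =>
    rw [Diagram.reduceAll, Option.bind_eq_some_iff] at hr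
    obtain ⟨D₁, h1, h2⟩ := hr
    have hc1 : c.1 ≠ c.2 := hc c List.mem_cons_self
    obtain ⟨s, t, L, rfl, hp⟩ := h.exists_of_reduce hc1 h1
    obtain ⟨i1, i2, i3⟩ := ih (h.reduce hc1 h1) (fun c hc' => hc c (List.mem_cons_of_mem _ hc')) h2
    have := hp.length_eq
    simp only [List.length_cons] at this i2 i3 ⊢
    exact ⟨i1, by omega, by omega⟩

theorem Diagram.reduceAll_append (D : Diagram n twok twoj) (cs ds : List (Fin n × Fin n)) :
    D.reduceAll (cs ++ ds) = (D.reduceAll cs).bind fun D' => D'.reduceAll ds := by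
  induction cs generalizing D with
  | nil => rfl
  | cons c cs ih =>
    simp only [List.cons_append, Diagram.reduceAll, Option.bind_assoc, ih]

end Reduce

section Symmetrise

variable {M : Type*} [AddCommGroup M] [Module ℂ M] {twok twoj : ℕ}

/-- The symmetrisation of the outflowing lines as a linear map. -/
noncomputable def symmOutflow (M : Type*) [AddCommGroup M] [Module ℂ M] (twok twoj : ℕ) :
    ((Outflow twok twoj → Fin 2) → M) →ₗ[ℂ] ((Outflow twok twoj → Fin 2) → M) where
  toFun := symmetriseOutflow
  map_add' Ψ Φ := by
    funext A
    simp [symmetriseOutflow, Finset.sum_add_distrib]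
  map_smul' c Ψ := by
    funext A
    simp only [symmetriseOutflow, Pi.smul_apply, ← Finset.smul_sum, RingHom.id_apply]
    rw [smul_comm]

theorem symmOutflow_apply (Ψ : (Outflow twok twoj → Fin 2) → M) :
    symmOutflow M twok twoj Ψ = symmetriseOutflow Ψ := rfl

theorem symmOutflow_comp_perm (Ψ : (Outflow twok twoj → Fin 2) → M) (ρ : Equiv.Perm (Fin twok))
    (κ : Equiv.Perm (Fin twoj)) :
    symmOutflow M twok twoj (fun A => Ψ (A ∘ Sum.map ρ κ)) = symmOutflow M twok twoj Ψ := by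
  funext A
  simp only [symmOutflow_apply, symmetriseOutflow]
  congr 1
  rw [← Equiv.sum_comp (Equiv.mulRight ρ)
    (fun ρ' => ∑ κ' : Equiv.Perm (Fin twoj), Ψ (A ∘ Sum.map ρ' κ'))]
  refine Finset.sum_congr rfl fun ρ' _ => ?_
  rw [← Equiv.sum_comp (Equiv.mulRight κ) (fun κ' => Ψ (A ∘ Sum.map (Equiv.mulRight ρ ρ') κ'))]
  refine Finset.sum_congr rfl fun κ' _ => ?_
  rw [Function.comp_assoc, Sum.map_comp_map]
  rfl

theorem symmOutflow_map {N : Type*} [AddCommGroup N] [Module ℂ N] (φ : M →ₗ[ℂ] N)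
    (Ψ : (Outflow twok twoj → Fin 2) → M) (A : Outflow twok twoj → Fin 2) :
    φ (symmOutflow M twok twoj Ψ A) = symmOutflow N twok twoj (fun A => φ (Ψ A)) A := by
  simp only [symmOutflow_apply, symmetriseOutflow, map_smul, map_sum]

/-- Spin 1/2 lines that leave at the same point of outflow may be exchanged under the
symmetrisation. -/
theorem symmOutflow_swap (Ψ : (Outflow twok twoj → Fin 2) → M) {s t : Outflow twok twoj}
    (h : s.isLeft = t.isLeft) :
    symmOutflow M twok twoj (fun A => Ψ (A ∘ Equiv.swap s t)) = symmOutflow M twok twoj Ψ := by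
  rcases s with i | i <;> rcases t with j | j
  · rw [← symmOutflow_comp_perm Ψ (Equiv.swap i j) 1]
    congr 1
    funext A
    congr 2
    funext x
    rcases x with x | x
    · exact (Sum.inl_injective.map_swap i j x).symm
    · simp [Equiv.swap_apply_of_ne_of_ne]
  · simp at h
  · simp at h
  · rw [← symmOutflow_comp_perm Ψ 1 (Equiv.swap i j)]
    congr 1
    funext A
    congr 2
    funext x
    rcases x with x | x
    · simp [Equiv.swap_apply_of_ne_of_ne]
    · exact (Sum.inr_injective.map_swap i j x).symm

end Symmetrise

/-! ### The squared total spin of a diagram -/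

section Exchange

variable {n twok twoj : ℕ} {R : Type*} [CommRing R] [Algebra ℂ R]
  {τ : Fin n → FermionType} {D : Diagram n twok twoj}

theorem Diagram.IsProper.type_ne_iff (h : D.IsProper τ) {a b : Fin n} {s t : Outflow twok twoj}
    (ha : (a, s) ∈ D.legs) (hb : (b, t) ∈ D.legs) : τ a ≠ τ b ↔ s.isLeft ≠ t.isLeft := by
  rcases s with s | s <;> rcases t with t | t
  · simp [h.top_type _ _ ha, h.top_type _ _ hb]
  · simp [h.top_type _ _ ha, h.bot_type _ _ hb]
  · simp [h.bot_type _ _ ha, h.top_type _ _ hb]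
  · simp [h.bot_type _ _ ha, h.bot_type _ _ hb]

/-- Two legs of a diagram, split off its weight. -/
theorem Diagram.IsProper.exists_weight_eq (h : D.IsProper τ)
    (H : Outflow twok twoj → Matrix (Fin 2) (Fin 2) R) {a b : Fin n} {s t : Outflow twok twoj}
    (ha : (a, s) ∈ D.legs) (hb : (b, t) ∈ D.legs) (hab : a ≠ b) :
    s ≠ t ∧ ∃ D₁ D₂ : Diagram n twok twoj, D.reduce (a, b) = some D₁ ∧
      (∀ A C, D.weight H A C = H s (C a) (A s) * H t (C b) (A t) * D₂.weight H A C) ∧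
      (∀ A C, D₁.weight H A C = algebraMap ℂ R (binor (C a) (C b)) *
        (∑ F : Fin 2, ∑ G : Fin 2, algebraMap ℂ R (binor F G) * H s F (A s) * H t G (A t)) *
          D₂.weight H A C) ∧
      (∀ A A' C C', (∀ x, x ≠ s → x ≠ t → A x = A' x) → (∀ x, x ≠ a → x ≠ b → C x = C' x) →
        D₂.weight H A C = D₂.weight H A' C') := by
  obtain ⟨L, hL, hp⟩ := reduce_of_mem h.legs_nodup ha hb hab
  have hf : D.fermions.Perm
      (a :: b :: fermions (⟨L, D.links, D.holonomies⟩ : Diagram n twok twoj)) :=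
    (hp.map Prod.fst).append_right _
  have ho : D.outflow.Perm
      (s :: t :: outflow (⟨L, D.links, D.holonomies⟩ : Diagram n twok twoj)) :=
    (hp.map Prod.snd).append_right _
  have hf' := hf.nodup_iff.mp h.fermions_nodup
  have ho' := ho.nodup_iff.mp h.outflow_nodup
  simp only [List.nodup_cons, List.mem_cons, not_or] at hf' ho'
  refine ⟨ho'.1.1, _, ⟨L, D.links, D.holonomies⟩, hL, fun A C => ?_, fun A C => ?_,
    fun A A' C C' hA hC => ?_⟩
  · rw [mul_assoc, weight_perm (D' := ⟨(a, s) :: (b, t) :: L, D.links, D.holonomies⟩) hp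
      (List.Perm.refl _) (List.Perm.refl _), weight_cons_leg, weight_cons_leg]
  · rw [weight_cons_link, weight_cons_holonomy, mul_assoc]
  · refine weight_congr _ (fun x hx => hA x ?_ ?_) (fun x hx => hC x ?_ ?_)
    · rintro rfl; exact ho'.1.2 hx
    · rintro rfl; exact ho'.2.1 hx
    · rintro rfl; exact hf'.1.2 hx
    · rintro rfl; exact hf'.2.1 hx

/-- Exchanging two fermions on legs is the same as exchanging the outflowing lines, if these carry
the same holonomy. -/
theorem Diagram.IsProper.weight_swap_same (h : D.IsProper τ)
    (H : Outflow twok twoj → Matrix (Fin 2) (Fin 2) R) {a b : Fin n} {s t : Outflow twok twoj}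
    (ha : (a, s) ∈ D.legs) (hb : (b, t) ∈ D.legs) (hab : a ≠ b) (hst : H s = H t)
    (A : Outflow twok twoj → Fin 2) (C : Fin n → Fin 2) :
    D.weight H A (C ∘ Equiv.swap a b) = D.weight H (A ∘ Equiv.swap s t) C := by
  obtain ⟨-, D₁, D₂, -, h2, -, h4⟩ := h.exists_weight_eq H ha hb hab
  rw [h2, h2, h4 A (A ∘ Equiv.swap s t) _ C]
  · simp only [Function.comp, Equiv.swap_apply_left, Equiv.swap_apply_right, hst]
    ring
  · intro x hs ht
    simp [Equiv.swap_apply_of_ne_of_ne hs ht]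
  · intro x hs ht
    simp [Equiv.swap_apply_of_ne_of_ne hs ht]

/-- Exchanging two fermions on legs adds the reduction by these fermions: the binor identity
`X = ∥ + ≍` for the lines of the legs. -/
theorem Diagram.IsProper.weight_swap_reduce (h : D.IsProper τ)
    (H : Outflow twok twoj → Matrix (Fin 2) (Fin 2) R) {a b : Fin n} {s t : Outflow twok twoj}
    (ha : (a, s) ∈ D.legs) (hb : (b, t) ∈ D.legs) (hab : a ≠ b) :
    ∃ D₁, D.reduce (a, b) = some D₁ ∧ ∀ A C,
      D.weight H A (C ∘ Equiv.swap a b) = D.weight H A C + D₁.weight H A C := by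
  obtain ⟨-, D₁, D₂, h1, h2, h3, h4⟩ := h.exists_weight_eq H ha hb hab
  refine ⟨D₁, h1, fun A C => ?_⟩
  rw [h2, h2, h3, h4 A A (C ∘ Equiv.swap a b) C (fun _ _ _ => rfl)
    fun x hs ht => by simp [Equiv.swap_apply_of_ne_of_ne hs ht]]
  simp only [Function.comp, Equiv.swap_apply_left, Equiv.swap_apply_right, ← add_mul]
  congr 1
  have hI : algebraMap ℂ R Complex.I * algebraMap ℂ R Complex.I = -1 := by
    rw [← map_mul, Complex.I_mul_I, map_neg, map_one]
  have key (x y : Fin 2) (f g : Fin 2 → R) : f y * g x = f x * g y +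
      algebraMap ℂ R (binor x y) * ∑ F, ∑ G, algebraMap ℂ R (binor F G) * f F * g G := by
    fin_cases x <;> fin_cases y <;> simp [binor, Fin.sum_univ_two] <;>
      first
        | linear_combination (f 0 * g 1 - f 1 * g 0) * hI
        | linear_combination (f 1 * g 0 - f 0 * g 1) * hI
  exact key (C a) (C b) (fun F => H s F (A s)) (fun G => H t G (A t))

end Exchange

section Eval

variable {Pt : Type u} [Groupoid.{v} Pt] {n twok twoj : ℕ} {E : EdgeSet Pt n} {top bot : Pt}
  {p : E.target ⟶ top} {q : E.target ⟶ bot} {τ : Fin n → FermionType} {D D' : Diagram n twok twoj}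

theorem Diagram.eval_eq_sum_weight (D : Diagram n twok twoj) (A : Outflow twok twoj → Fin 2) :
    D.eval E p q A = ∑ C, D.weight (outflowHol p q) A C • basicState E C := rfl

theorem outflowHol_eq {s t : Outflow twok twoj} (h : s.isLeft = t.isLeft) :
    outflowHol p q s = outflowHol p q t := by
  rcases s with s | s <;> rcases t with t | t
  · rfl
  · simp at h
  · simp at h
  · rfl

theorem Diagram.evalReduced_nil (D : Diagram n twok twoj) (A : Outflow twok twoj → Fin 2) :
    D.evalReduced E p q [] A = D.eval E p q A := rfl

theorem Diagram.evalReduced_of_eq_some {cs : List (Fin n × Fin n)} (h : D.reduceAll cs = some D')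
    (A : Outflow twok twoj → Fin 2) : D.evalReduced E p q cs A = D'.eval E p q A := by
  simp only [evalReduced, h]

theorem Diagram.evalReduced_of_eq_none {cs : List (Fin n × Fin n)} (h : D.reduceAll cs = none)
    (A : Outflow twok twoj → Fin 2) : D.evalReduced E p q cs A = 0 := by
  simp only [evalReduced, h]

theorem Diagram.reduceAll_singleton (D : Diagram n twok twoj) (c : Fin n × Fin n) :
    D.reduceAll [c] = D.reduce c := by
  simp only [reduceAll]
  cases D.reduce c <;> rfl

variable (E p q) in
/-- The state of a diagram in which the fermions `a` and `b` have exchanged their lines. -/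
noncomputable def Diagram.evalSwap (D : Diagram n twok twoj) (a b : Fin n)
    (A : Outflow twok twoj → Fin 2) : States Pt :=
  ∑ C, D.weight (outflowHol p q) A (C ∘ Equiv.swap a b) • basicState E C

variable (E p q τ) in
/-- The reduction of a diagram by two fermions of different type. -/
noncomputable def Diagram.evalPair (D : Diagram n twok twoj) (a b : Fin n) :
    (Outflow twok twoj → Fin 2) → States Pt :=
  if τ a = τ b then 0 else D.evalReduced E p q [(a, b)]

/-- Under the symmetrisation, exchanging two fermions on legs adds the reduction by these fermions
if they are of different type, and has no effect otherwise. -/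
theorem Diagram.IsProper.symm_evalSwap (h : D.IsProper τ) {a b : Fin n} {s t : Outflow twok twoj}
    (ha : (a, s) ∈ D.legs) (hb : (b, t) ∈ D.legs) :
    symmOutflow _ _ _ (D.evalSwap E p q a b) =
      symmOutflow _ _ _ (D.eval E p q) + symmOutflow _ _ _ (D.evalPair E p q τ a b) := by
  by_cases hab : a = b
  · subst hab
    have : D.evalSwap E p q a a = D.eval E p q := by
      funext A
      simp only [evalSwap, Equiv.swap_self, Equiv.coe_refl, Function.comp_id,
        eval_eq_sum_weight]
    rw [this, evalPair, if_pos rfl, map_zero, add_zero]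
  by_cases hst : s.isLeft = t.isLeft
  · have hτ : τ a = τ b := by
      by_contra hne
      exact (h.type_ne_iff ha hb).mp hne hst
    have : D.evalSwap E p q a b = fun A => D.eval E p q (A ∘ Equiv.swap s t) := by
      funext A
      simp only [evalSwap, eval_eq_sum_weight,
        h.weight_swap_same _ ha hb hab (outflowHol_eq hst)]
    rw [this, symmOutflow_swap _ hst, evalPair, if_pos hτ, map_zero, add_zero]
  · have hτ : τ a ≠ τ b := (h.type_ne_iff ha hb).mpr hst
    obtain ⟨D₁, h1, h2⟩ := h.weight_swap_reduce (outflowHol p q) ha hb hab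
    rw [evalPair, if_neg hτ, ← map_add]
    congr 1
    funext A
    rw [Pi.add_apply, evalReduced_of_eq_some ((reduceAll_singleton D _).trans h1)]
    simp only [evalSwap, eval_eq_sum_weight, h2, add_smul, Finset.sum_add_distrib]

theorem Diagram.evalPair_eq_zero {a b : Fin n}
    (h : ¬ (a ∈ D.legs.map Prod.fst ∧ b ∈ D.legs.map Prod.fst)) : D.evalPair E p q τ a b = 0 := by
  unfold evalPair
  split_ifs
  · rfl
  · funext A
    refine evalReduced_of_eq_none ?_ A
    rw [reduceAll_singleton]
    cases hr : D.reduce (a, b) with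
    | none => rfl
    | some D' =>
      obtain ⟨⟨s, hs⟩, t, ht⟩ := mem_of_reduce_eq_some hr
      exact absurd ⟨List.mem_map_of_mem hs, List.mem_map_of_mem ht⟩ h

theorem Diagram.IsProper.symm_evalPair_comm (h : D.IsProper τ) (a b : Fin n) :
    symmOutflow _ _ _ (D.evalPair E p q τ a b) = symmOutflow _ _ _ (D.evalPair E p q τ b a) := by
  by_cases hm : a ∈ D.legs.map Prod.fst ∧ b ∈ D.legs.map Prod.fst
  · obtain ⟨⟨l, hl, rfl⟩, l', hl', rfl⟩ := hm.imp List.mem_map.mp List.mem_map.mp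
    have h1 := h.symm_evalSwap (E := E) (p := p) (q := q) (a := l.1) (s := l.2) (b := l'.1)
      (t := l'.2) hl hl'
    have h2 := h.symm_evalSwap (E := E) (p := p) (q := q) (a := l'.1) (s := l'.2) (b := l.1)
      (t := l.2) hl' hl
    have h3 : D.evalSwap E p q l.1 l'.1 = D.evalSwap E p q l'.1 l.1 := by
      funext A
      simp only [evalSwap, Equiv.swap_comm]
    rw [h3, h2] at h1
    exact (add_left_cancel h1).symm
  · rw [evalPair_eq_zero hm, evalPair_eq_zero fun h => hm h.symm]

/-- A symmetric function that vanishes on the diagonal is summed over the pairs `a < b`. -/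
theorem sum_sum_eq_two_nsmul_sum_pairs {M : Type*} [AddCommMonoid M] (g : Fin n → Fin n → M)
    (hs : ∀ a b, g a b = g b a) (hd : ∀ a, g a a = 0) :
    ∑ a, ∑ b, g a b = 2 • ∑ c : FermionPair n, g c.1.1 c.1.2 := by
  have h1 : ∑ c : FermionPair n, g c.1.1 c.1.2 = ∑ a, ∑ b, if a < b then g a b else 0 := by
    rw [← Finset.sum_product', Finset.univ_product_univ, ← Finset.sum_filter]
    exact (Finset.sum_subtype _ (by simp) fun c : Fin n × Fin n => g c.1 c.2).symm
  have h2 : ∑ a, ∑ b, g a b =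
      ∑ a, ∑ b, ((if a < b then g a b else 0) + if b < a then g b a else 0) := by
    refine Finset.sum_congr rfl fun a _ => Finset.sum_congr rfl fun b _ => ?_
    rcases lt_trichotomy a b with hab | rfl | hab
    · simp [hab, hab.not_gt]
    · simp [hd]
    · simp [hab, hab.not_gt, hs a b]
  rw [h2, two_nsmul, h1]
  simp only [Finset.sum_add_distrib]
  congr 1
  exact Finset.sum_comm

/-- The squared total spin of a symmetrised diagram: the diagram is an eigenstate up to its
reductions. -/
theorem Diagram.IsProper.totalSpinSq_symm_eval (h : D.IsProper τ)
    (A : Outflow twok twoj → Fin 2) :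
    totalSpinSq E (symmOutflow _ _ _ (D.eval E p q) A) =
      ((D.legs.length : ℂ) / 2 * ((D.legs.length : ℂ) / 2 + 1)) •
        symmOutflow _ _ _ (D.eval E p q) A +
      ∑ c : FermionPair n, symmOutflow _ _ _ (D.evalPair E p q τ c.1.1 c.1.2) A := by
  have hn : (n : ℂ) = (D.legs.length : ℂ) + 2 * (D.links.length : ℂ) := by
    exact_mod_cast h.card_fermions
  have hS : (fun A => totalSpinSq E (D.eval E p q A)) =
      (((n : ℂ) / 2 - (n : ℂ) ^ 2 / 4) +
        2⁻¹ * ((D.links.length : ℂ) * ((n : ℂ) - 2 + D.legs.length))) • D.eval E p q +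
      (2⁻¹ : ℂ) • (D.legs.map fun l => (D.legs.map fun l' =>
        D.evalSwap E p q l.1 l'.1).sum).sum := by
    funext A
    have hsum : (D.legs.map fun l => (D.legs.map fun l' =>
        D.evalSwap E p q l.1 l'.1).sum).sum A =
        ∑ C, (D.legs.map fun l => (D.legs.map fun l' =>
          D.weight (outflowHol p q) A (C ∘ Equiv.swap l.1 l'.1)).sum).sum • basicState E C := by
      have e (l : List (Fin n × Outflow twok twoj)) (f : Fin n × Outflow twok twoj →
          (Fin n → Fin 2) → Cyl Pt) : ∑ C, (l.map fun x => f x C).sum • basicState E C =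
          (l.map fun x => ∑ C, f x C • basicState E C).sum := by
        induction l with
        | nil => simp
        | cons x l ih => simp only [List.map_cons, List.sum_cons, add_smul,
            Finset.sum_add_distrib, ih]
      have ev (l : List (Fin n × Outflow twok twoj)) (f : Fin n × Outflow twok twoj →
          (Outflow twok twoj → Fin 2) → States Pt) :
          (l.map f).sum A = (l.map fun x => f x A).sum := by
        induction l with
        | nil => rfl
        | cons x l ih => simp only [List.map_cons, List.sum_cons, Pi.add_apply, ih]
      simp only [e, ev, evalSwap]
    rw [Pi.add_apply, Pi.smul_apply, Pi.smul_apply, hsum, eval_eq_sum_weight,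
      totalSpinSq_sum_smul, Finset.smul_sum, Finset.smul_sum, ← Finset.sum_add_distrib]
    refine Finset.sum_congr rfl fun C _ => ?_
    rw [h.sum_weight_swap, ← smul_assoc, ← smul_assoc, ← add_smul]
    congr 1
    module
  have hpairs : (D.legs.map fun l => (D.legs.map fun l' =>
        symmOutflow _ _ _ (D.evalSwap E p q l.1 l'.1)).sum).sum =
      ((D.legs.length : ℂ) ^ 2) • symmOutflow _ _ _ (D.eval E p q) +
        (2 : ℂ) • ∑ c : FermionPair n, symmOutflow _ _ _ (D.evalPair E p q τ c.1.1 c.1.2) := by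
    have e1 : ∀ l ∈ D.legs, (D.legs.map fun l' =>
        symmOutflow _ _ _ (D.evalSwap E p q l.1 l'.1)).sum =
        (D.legs.length : ℂ) • symmOutflow _ _ _ (D.eval E p q) +
          ∑ b, symmOutflow _ _ _ (D.evalPair E p q τ l.1 b) := by
      intro l hl
      rw [List.map_congr_left fun l' hl' => h.symm_evalSwap (s := l.2) (t := l'.2) hl hl',
        List.sum_map_add, h.sum_fermions]
      have : ∀ l' ∈ D.links, symmOutflow _ _ _ (D.evalPair E p q τ l.1 l'.1) +
          symmOutflow _ _ _ (D.evalPair E p q τ l.1 l'.2) = 0 := by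
        intro l' hl'
        have hnd := (List.nodup_append.mp h.fermions_nodup).2.2
        rw [evalPair_eq_zero, evalPair_eq_zero]
        · simp
        · exact fun hm => hnd _ hm.2 _
            (List.mem_append_right _ (List.mem_map_of_mem hl')) rfl
        · exact fun hm => hnd _ hm.2 _
            (List.mem_append_left _ (List.mem_map_of_mem hl')) rfl
      rw [List.map_congr_left this]
      simp [← Nat.cast_smul_eq_nsmul ℂ]
    have e2 : ∀ l ∈ D.links, ∑ b, symmOutflow _ _ _ (D.evalPair E p q τ l.1 b) +
        ∑ b, symmOutflow _ _ _ (D.evalPair E p q τ l.2 b) = 0 := by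
      intro l hl
      have hnd := (List.nodup_append.mp h.fermions_nodup).2.2
      rw [← Finset.sum_add_distrib]
      refine Finset.sum_eq_zero fun b _ => ?_
      rw [evalPair_eq_zero, evalPair_eq_zero]
      · simp
      · exact fun hm => hnd _ hm.1 _
          (List.mem_append_right _ (List.mem_map_of_mem hl)) rfl
      · exact fun hm => hnd _ hm.1 _
          (List.mem_append_left _ (List.mem_map_of_mem hl)) rfl
    have e3 := h.sum_fermions fun a => ∑ b, symmOutflow _ _ _ (D.evalPair E p q τ a b)
    rw [List.map_congr_left e2] at e3
    rw [List.map_congr_left e1, List.sum_map_add]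
    simp only [List.map_const', List.sum_replicate, smul_zero, add_zero] at e3
    rw [← e3, sum_sum_eq_two_nsmul_sum_pairs _ h.symm_evalPair_comm fun a => by
      rw [evalPair, if_pos rfl, map_zero]]
    simp only [List.map_const', List.sum_replicate, ← Nat.cast_smul_eq_nsmul ℂ, smul_smul, sq]
    simp
  have hlist {l : List (Fin n × Outflow twok twoj)} (f : Fin n × Outflow twok twoj →
      (Outflow twok twoj → Fin 2) → States Pt) :
      symmOutflow (States Pt) twok twoj (l.map f).sum =
        (l.map fun x => symmOutflow (States Pt) twok twoj (f x)).sum := by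
    rw [map_list_sum, List.map_map]
    rfl
  rw [symmOutflow_map, hS, map_add, map_smul, map_smul]
  simp only [hlist]
  rw [hpairs, Pi.add_apply, Pi.smul_apply, Pi.smul_apply, Pi.add_apply, Pi.smul_apply,
    Pi.smul_apply, Finset.sum_apply, hn]
  module

end Eval

/-! ### The series of reductions is an eigenstate -/

section Series

variable {Pt : Type u} [Groupoid.{v} Pt] {n twok twoj : ℕ} {E : EdgeSet Pt n} {top bot : Pt}
  {p : E.target ⟶ top} {q : E.target ⟶ bot} {τ : Fin n → FermionType} {D D' : Diagram n twok twoj}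

variable (E p q τ) in
open Classical in
/-- The sum of all `m`-fold reductions by pairs of fermions of different type. -/
noncomputable def Diagram.level (D : Diagram n twok twoj) (m : ℕ)
    (A : Outflow twok twoj → Fin 2) : States Pt :=
  ∑ r : Fin m → FermionPair n, if ∃ i, τ (r i).1.1 = τ (r i).1.2 then 0 else
    D.evalReduced E p q (List.ofFn fun i => (r i).1) A

theorem Diagram.series_eq_sum_level (D : Diagram n twok twoj) :
    D.series E p q τ =
      ∑ m ∈ Finset.range (n / 2 + 1), (invCoeff twok twoj m)⁻¹ • D.level E p q τ m := by
  funext A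
  rw [Finset.sum_apply]
  refine Finset.sum_congr rfl fun m _ => ?_
  rw [Pi.smul_apply, level, Finset.smul_sum]
  refine Finset.sum_congr rfl fun r _ => ?_
  unfold coeff
  split_ifs
  · rw [zero_smul, smul_zero]
  · rfl

theorem Diagram.level_zero (D : Diagram n twok twoj) : D.level E p q τ 0 = D.eval E p q := by
  funext A
  simp [level, evalReduced_nil]

theorem Diagram.level_succ (D : Diagram n twok twoj) (m : ℕ) :
    D.level E p q τ (m + 1) = ∑ r : Fin m → FermionPair n, ∑ c : FermionPair n,
      if ∃ i, τ (r i).1.1 = τ (r i).1.2 then 0 else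
        match D.reduceAll (List.ofFn fun i => (r i).1) with
        | some D' => D'.evalPair E p q τ c.1.1 c.1.2
        | none => 0 := by
  classical
  funext A
  rw [level, Finset.sum_comm, ← Finset.sum_product', Finset.univ_product_univ, Finset.sum_apply]
  rw [← (Fin.snocEquiv fun _ => FermionPair n).sum_comp]
  refine Finset.sum_congr rfl fun x _ => ?_
  obtain ⟨c, r⟩ := x
  have h1 : (∃ i, τ ((Fin.snocEquiv fun _ => FermionPair n) (c, r) i).1.1 =
      τ ((Fin.snocEquiv fun _ => FermionPair n) (c, r) i).1.2) ↔
      (∃ i, τ (r i).1.1 = τ (r i).1.2) ∨ τ c.1.1 = τ c.1.2 := by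
    rw [Fin.exists_fin_succ']
    simp [Fin.snocEquiv]
  have h2 : (List.ofFn fun i => ((Fin.snocEquiv fun _ => FermionPair n) (c, r) i).1) =
      (List.ofFn fun i => (r i).1) ++ [c.1] := by
    rw [List.ofFn_succ', List.concat_eq_append]
    simp [Fin.snocEquiv]
  simp only [h1, h2]
  by_cases hr : ∃ i, τ (r i).1.1 = τ (r i).1.2
  · simp [hr]
  simp only [hr, false_or, if_false]
  cases hD : D.reduceAll (List.ofFn fun i => (r i).1) with
  | none =>
    have := reduceAll_append D (List.ofFn fun i => (r i).1) [c.1]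
    rw [hD] at this
    simp [evalReduced_of_eq_none this]
  | some D' =>
    simp only [evalPair]
    split_ifs
    · rfl
    · have := reduceAll_append D (List.ofFn fun i => (r i).1) [c.1]
      rw [hD, Option.bind_some] at this
      simp only [evalReduced, this]

theorem Diagram.IsProper.level_eq_zero (h : D.IsProper τ) {m : ℕ} (hm : D.legs.length < 2 * m) :
    D.level E p q τ m = 0 := by
  funext A
  refine Finset.sum_eq_zero fun r _ => ?_
  split_ifs
  · rfl
  refine evalReduced_of_eq_none ?_ A
  cases hr : D.reduceAll (List.ofFn fun i => (r i).1) with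
  | none => rfl
  | some D' =>
    have := (h.reduceAll (by
      intro c hc
      obtain ⟨i, rfl⟩ := List.mem_ofFn.mp hc
      exact (r i).2.ne) hr).2.1
    rw [List.length_ofFn] at this
    omega

/-- The squared total spin maps the `m`-fold reductions to a multiple of themselves and the
`(m + 1)`-fold reductions. -/
theorem Diagram.IsProper.totalSpinSq_symm_level (h : D.IsProper τ) (m : ℕ)
    (A : Outflow twok twoj → Fin 2) :
    totalSpinSq E (symmOutflow _ _ _ (D.level E p q τ m) A) =
      (((D.legs.length : ℂ) / 2 - m) * ((D.legs.length : ℂ) / 2 - m + 1)) •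
        symmOutflow _ _ _ (D.level E p q τ m) A +
      symmOutflow _ _ _ (D.level E p q τ (m + 1)) A := by
  classical
  have hlev : D.level E p q τ m = ∑ r : Fin m → FermionPair n,
      if ∃ i, τ (r i).1.1 = τ (r i).1.2 then 0 else
        D.evalReduced E p q (List.ofFn fun i => (r i).1) := by
    funext A
    rw [level, Finset.sum_apply]
    refine Finset.sum_congr rfl fun r _ => ?_
    split_ifs <;> rfl
  rw [hlev, level_succ]
  simp only [map_sum, Finset.sum_apply, Finset.smul_sum]
  rw [← Finset.sum_add_distrib]
  refine Finset.sum_congr rfl fun r _ => ?_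
  by_cases hr : ∃ i, τ (r i).1.1 = τ (r i).1.2
  · simp [hr]
  simp only [hr, if_false]
  cases hD : D.reduceAll (List.ofFn fun i => (r i).1) with
  | none =>
    have : D.evalReduced E p q (List.ofFn fun i => (r i).1) = 0 :=
      funext fun A => evalReduced_of_eq_none hD A
    simp [this]
  | some D' =>
    have he : D.evalReduced E p q (List.ofFn fun i => (r i).1) = D'.eval E p q :=
      funext fun A => evalReduced_of_eq_some hD A
    obtain ⟨h1, h2, -⟩ := h.reduceAll (by
      intro c hc
      obtain ⟨i, rfl⟩ := List.mem_ofFn.mp hc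
      exact (r i).2.ne) hD
    rw [List.length_ofFn] at h2
    have h3 : (D.legs.length : ℂ) / 2 - m = (D'.legs.length : ℂ) / 2 := by
      rw [h2]
      push_cast
      ring
    rw [he, h1.totalSpinSq_symm_eval, h3]

/-- The coefficients are chosen such that the sum of all reductions telescopes to an
eigenstate. -/
theorem Diagram.IsProper.totalSpinSq_symm_series (h : D.IsProper τ)
    (hN : D.legs.length = twok + twoj) (A : Outflow twok twoj → Fin 2) :
    totalSpinSq E (symmOutflow _ _ _ (D.series E p q τ) A) =
      (((twoj : ℂ) / 2 + (twok : ℂ) / 2) * ((twoj : ℂ) / 2 + (twok : ℂ) / 2 + 1)) •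
        symmOutflow _ _ _ (D.series E p q τ) A := by
  set x : ℂ := (twoj : ℂ) / 2 + (twok : ℂ) / 2 with hx
  have hlen : (D.legs.length : ℂ) / 2 = x := by
    rw [hN]
    push_cast
    ring
  set f : ℕ → States Pt := fun m => symmOutflow _ _ _ (D.level E p q τ m) A with hf
  have hS : symmOutflow _ _ _ (D.series E p q τ) A =
      ∑ m ∈ Finset.range (n / 2 + 1), (invCoeff twok twoj m)⁻¹ • f m := by
    simp only [series_eq_sum_level, map_sum, map_smul, Finset.sum_apply, Pi.smul_apply, hf]
  have hstep (m : ℕ) : totalSpinSq E (f m) = ((x - m) * (x - m + 1)) • f m + f (m + 1) := by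
    simp only [hf, h.totalSpinSq_symm_level, hlen]
  have hzero {m : ℕ} (hm : twok + twoj < 2 * m) : f m = 0 := by
    simp only [hf, h.level_eq_zero (hN.trans_lt hm), map_zero, Pi.zero_apply]
  have tele (M : ℕ) : ∑ m ∈ Finset.range (M + 1), (invCoeff twok twoj m)⁻¹ • totalSpinSq E (f m) =
      (x * (x + 1)) • ∑ m ∈ Finset.range (M + 1), (invCoeff twok twoj m)⁻¹ • f m +
        (invCoeff twok twoj M)⁻¹ • f (M + 1) := by
    induction M with
    | zero =>
      simp only [zero_add, Finset.sum_range_one, hstep]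
      push_cast
      module
    | succ M ih =>
      rw [Finset.sum_range_succ, ih, Finset.sum_range_succ _ (M + 1), hstep (M + 1)]
      -- `invCoeff` may vanish only where there are no reductions left.
      by_cases hM : twok + twoj < 2 * (M + 1)
      · rw [hzero hM]
        module
      · have hne : (twoj : ℂ) + twok - ((M + 1 : ℕ) : ℂ) + 1 ≠ 0 := by
          have : (twoj : ℂ) + twok - ((M + 1 : ℕ) : ℂ) + 1 = ((twoj + twok - M : ℕ) : ℂ) := by
            rw [Nat.cast_sub (by omega)]
            push_cast
            ring
          rw [this, Nat.cast_ne_zero]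
          omega
        have hinv : (invCoeff twok twoj M)⁻¹ = (invCoeff twok twoj (M + 1))⁻¹ *
            (((M + 1 : ℕ) : ℂ) * ((twoj : ℂ) + twok - ((M + 1 : ℕ) : ℂ) + 1)) := by
          rw [invCoeff, mul_inv]
          have : ((M + 1 : ℕ) : ℂ) ≠ 0 := Nat.cast_ne_zero.mpr (Nat.succ_ne_zero M)
          field_simp
        rw [hinv]
        have h2x : (twoj : ℂ) + twok = 2 * x := by
          rw [hx]
          ring
        rw [h2x]
        push_cast
        module
  have hle : D.legs.length ≤ n := by
    have := h.card_fermions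
    omega
  rw [hS, map_sum]
  simp only [map_smul]
  rw [tele, hzero (by omega), smul_zero, add_zero]

end Series

/-! ### The component in which all outflowing indices vanish -/

section Coefficient

variable {Pt : Type u} [Groupoid.{v} Pt] {n twok twoj : ℕ}

/-- The connection all of whose holonomies are trivial. -/
def trivialConnection (Pt : Type u) [Groupoid.{v} Pt] : Connection Pt where
  hol _ := 1
  hol_comp _ _ := (mul_one 1).symm

/-- The fermion state at the trivial connection. -/
noncomputable def fockAt (Pt : Type u) [Groupoid.{v} Pt] : States Pt →ₗ[ℂ] Fock Pt :=
  (TensorProduct.lid ℂ (Fock Pt)).toLinearMap ∘ₗ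
    TensorProduct.map (cylEval (trivialConnection Pt)).toLinearMap LinearMap.id

theorem fockAt_tmul (f : Cyl Pt) (v : Fock Pt) :
    fockAt Pt (f ⊗ₜ v) = cylEval (trivialConnection Pt) f • v := by
  simp [fockAt]

theorem fockAt_act (f : Cyl Pt) (T : Module.End ℂ (Fock Pt)) (ψ : States Pt) :
    fockAt Pt (act f T ψ) = cylEval (trivialConnection Pt) f • T (fockAt Pt ψ) := by
  induction ψ using TensorProduct.induction_on with
  | zero => simp
  | tmul a b => simp [act, fockAt_tmul, mul_smul]
  | add x y hx hy => simp only [map_add, hx, hy, smul_add]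

theorem fockAt_smul (f : Cyl Pt) (ψ : States Pt) :
    fockAt Pt (f • ψ) = cylEval (trivialConnection Pt) f • fockAt Pt ψ := by
  induction ψ using TensorProduct.induction_on with
  | zero => simp
  | tmul a b => simp [TensorProduct.smul_tmul', fockAt_tmul, mul_smul]
  | add x y hx hy => simp only [map_add, hx, hy, smul_add]

theorem fockAt_dressedCreate {x y : Pt} (e : x ⟶ y) (A : Fin 2) (ψ : States Pt) :
    fockAt Pt (dressedCreate e A ψ) = create x A (fockAt Pt ψ) := by
  have h (B : Fin 2) : cylEval (trivialConnection Pt) (holMatrix e B A) =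
      if B = A then 1 else 0 := by
    rw [cylEval_holMatrix, ← Matrix.one_apply]
    rfl
  simp [dressedCreate, fockAt_act, h, -Fin.sum_univ_two]

theorem fockAt_basicState (E : EdgeSet Pt n) (C : Fin n → Fin 2) :
    fockAt Pt (basicState E C) =
      ExteriorAlgebra.ιMulti ℂ n fun a => Finsupp.single (E.source a) (Pi.single (C a) (1 : ℂ)) := by
  have h (l : List (Fin n)) :
      fockAt Pt ((l.map fun a => dressedCreate (E.edge a) (C a)).prod (1 ⊗ₜ[ℂ] 1)) =
      (l.map fun a => ExteriorAlgebra.ι ℂ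
        (Finsupp.single (E.source a) (Pi.single (C a) (1 : ℂ)) : OneParticle Pt)).prod := by
    induction l with
    | nil => simp [fockAt_tmul]
    | cons a l ih =>
      simp only [List.map_cons, List.prod_cons, Module.End.mul_apply, fockAt_dressedCreate, ih]
      rfl
  rw [basicState, List.ofFn_eq_map, h, ExteriorAlgebra.ιMulti_apply, List.ofFn_eq_map]

/-- The coefficient of the fermion state with one fermion at the source of each edge and the spinor
indices `K`, as a Slater determinant. -/
noncomputable def slater (E : EdgeSet Pt n) (K : Fin n → Fin 2) : Fock Pt →ₗ[ℂ] ℂ :=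
  ExteriorAlgebra.liftAlternating (Pi.single n
    ((Matrix.detRowAlternating (n := Fin n) (R := ℂ)).compLinearMap
      (LinearMap.pi fun b => (LinearMap.proj (K b) : (Fin 2 → ℂ) →ₗ[ℂ] ℂ) ∘ₗ
        Finsupp.lapply (E.source b))))

theorem slater_basic (E : EdgeSet Pt n) (K C : Fin n → Fin 2) :
    slater E K (ExteriorAlgebra.ιMulti ℂ n fun a =>
      Finsupp.single (E.source a) (Pi.single (C a) (1 : ℂ))) = if C = K then 1 else 0 := by
  classical
  rw [slater, ExteriorAlgebra.liftAlternating_apply_ιMulti, Pi.single_eq_same,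
    AlternatingMap.compLinearMap_apply]
  have : (fun a => (LinearMap.pi fun b => (LinearMap.proj (K b) : (Fin 2 → ℂ) →ₗ[ℂ] ℂ) ∘ₗ
        Finsupp.lapply (E.source b))
        (Finsupp.single (E.source a) (Pi.single (C a) (1 : ℂ)) : OneParticle Pt)) =
      Matrix.diagonal fun a => if C a = K a then (1 : ℂ) else 0 := by
    funext a b
    by_cases h : a = b
    · subst h
      simp [Pi.single_apply, eq_comm]
    · have hs : E.source a ≠ E.source b := fun hs => h (E.source_injective hs)
      simp [Matrix.diagonal_apply_ne _ h, Finsupp.single_eq_of_ne hs.symm]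
  have h2 := Matrix.det_diagonal (n := Fin n) (R := ℂ) (d := fun a => if C a = K a then (1 : ℂ) else 0)
  rw [← this] at h2
  refine h2.trans ?_
  by_cases hC : C = K
  · simp [hC]
  · rw [if_neg hC]
    obtain ⟨a, ha⟩ := Function.ne_iff.mp hC
    exact Finset.prod_eq_zero (Finset.mem_univ a) (if_neg ha)

/-- The coefficient of a state at the trivial connection and the spinor indices `K` of the
fermions. -/
noncomputable def coefficientAt (E : EdgeSet Pt n) (K : Fin n → Fin 2) : States Pt →ₗ[ℂ] ℂ :=
  slater E K ∘ₗ fockAt Pt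

variable {E : EdgeSet Pt n} {top bot : Pt} {p : E.target ⟶ top} {q : E.target ⟶ bot}
  {τ : Fin n → FermionType} {D D' : Diagram n twok twoj}

theorem coefficientAt_eval (D : Diagram n twok twoj) (K : Fin n → Fin 2)
    (A : Outflow twok twoj → Fin 2) :
    coefficientAt E K (D.eval E p q A) = D.weight (R := ℂ) (fun _ => 1) A K := by
  have hw : cylEval (trivialConnection Pt) (D.weight (outflowHol p q) A K) =
      D.weight (R := ℂ) (fun _ => 1) A K := by
    have h (s : Outflow twok twoj) (B C : Fin 2) :
        cylEval (trivialConnection Pt) (outflowHol p q s B C) =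
          (1 : Matrix (Fin 2) (Fin 2) ℂ) B C := by
      cases s <;> rfl
    simp only [Diagram.weight, map_mul, map_list_prod, List.map_map, Function.comp_def, map_sum, h,
      AlgHom.commutes]
  rw [Diagram.eval_eq_sum_weight, map_sum]
  simp only [coefficientAt, LinearMap.comp_apply, fockAt_smul, fockAt_basicState, map_smul,
    slater_basic, smul_eq_mul, mul_ite, mul_one, mul_zero, Finset.sum_ite_eq', Finset.mem_univ,
    if_true, hw]

/-- Two outflowing lines with the same index cannot be joined, since the binor line is
antisymmetric. -/
theorem Diagram.weight_one_zero_of_holonomies (hD : D.holonomies ≠ []) (K : Fin n → Fin 2) :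
    D.weight (R := ℂ) (fun _ => 1) 0 K = 0 := by
  obtain ⟨L, M, J⟩ := D
  cases J with
  | nil => exact absurd rfl hD
  | cons l J =>
    rw [weight_cons_holonomy]
    simp [binor, Fin.sum_univ_two]

/-- The reductions do not contribute to the component in which all outflowing indices are `0`. -/
theorem Diagram.IsProper.coefficientAt_symm_series (h : D.IsProper τ) (K : Fin n → Fin 2) :
    coefficientAt E K (symmOutflow _ _ _ (D.series E p q τ) 0) =
      D.weight (R := ℂ) (fun _ => 1) 0 K := by
  have hsymm (f : (Outflow twok twoj → Fin 2) → ℂ) : symmOutflow ℂ twok twoj f 0 = f 0 := by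
    have (ρ : Equiv.Perm (Fin twok)) (κ : Equiv.Perm (Fin twoj)) :
        f ((0 : Outflow twok twoj → Fin 2) ∘ Sum.map ρ κ) = f 0 := rfl
    have h1 : (twok.factorial : ℂ) ≠ 0 := Nat.cast_ne_zero.mpr (Nat.factorial_ne_zero _)
    have h2 : (twoj.factorial : ℂ) ≠ 0 := Nat.cast_ne_zero.mpr (Nat.factorial_ne_zero _)
    simp only [symmOutflow_apply, symmetriseOutflow, this, Finset.sum_const, Finset.card_univ,
      Fintype.card_perm, Fintype.card_fin, nsmul_eq_mul, smul_eq_mul]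
    push_cast
    field_simp
  have hlevel (m : ℕ) (hm : m ≠ 0) : coefficientAt E K (D.level E p q τ m 0) = 0 := by
    rw [level, map_sum]
    refine Finset.sum_eq_zero fun r _ => ?_
    split_ifs
    · exact map_zero _
    cases hD : D.reduceAll (List.ofFn fun i => (r i).1) with
    | none => rw [evalReduced_of_eq_none hD, map_zero]
    | some D' =>
      rw [evalReduced_of_eq_some hD, coefficientAt_eval, weight_one_zero_of_holonomies]
      have := (h.reduceAll (by
        intro c hc
        obtain ⟨i, rfl⟩ := List.mem_ofFn.mp hc
        exact (r i).2.ne) hD).2.2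
      rw [List.length_ofFn] at this
      exact List.ne_nil_of_length_pos (by omega)
  rw [symmOutflow_map, hsymm, series_eq_sum_level, Finset.sum_apply, map_sum,
    Finset.sum_eq_single 0]
  · rw [Pi.smul_apply, level_zero, map_smul, coefficientAt_eval, invCoeff, inv_one, one_smul]
  · intro m _ hm
    rw [Pi.smul_apply, map_smul, hlevel m hm, smul_zero]
  · simp

/-- The coefficient of a diagram without pure holonomies, provided that the fermions on legs have
the index of the outflowing lines. -/
theorem Diagram.weight_one_zero (hD : D.holonomies = []) {K : Fin n → Fin 2}
    (hK : ∀ l ∈ D.legs, K l.1 = 0) :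
    D.weight (R := ℂ) (fun _ => 1) 0 K = (D.links.map fun l => binor (K l.1) (K l.2)).prod := by
  have h1 : (D.legs.map fun l => (1 : Matrix (Fin 2) (Fin 2) ℂ) (K l.1)
      ((0 : Outflow twok twoj → Fin 2) l.2)).prod = 1 := by
    refine List.prod_eq_one fun x hx => ?_
    obtain ⟨l, hl, rfl⟩ := List.mem_map.mp hx
    rw [hK l hl]
    rfl
  rw [weight, h1, hD]
  simp

/-- A product of building blocks yields a nonzero state: all the reductions vanish if the
outflowing lines have the same index. -/
theorem Diagram.IsBlockProduct.symm_series_ne_zero (h : D.IsBlockProduct τ) :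
    symmOutflow _ _ _ (D.series E p q τ) ≠ 0 := by
  intro h0
  -- The two fermions of each link have different indices, so that the binor lines do not vanish.
  set K : Fin n → Fin 2 := fun a => if a ∈ D.links.map Prod.snd then 1 else 0 with hK
  have hnd := List.nodup_append.mp h.fermions_nodup
  have h1 := h.isProper.coefficientAt_symm_series (E := E) (p := p) (q := q) K
  rw [h0, Pi.zero_apply, map_zero, weight_one_zero h.holonomies_eq] at h1
  · refine List.prod_ne_zero (fun hz => ?_) h1.symm
    obtain ⟨l, hl, hz⟩ := List.mem_map.mp hz
    have e1 : K l.1 = 0 := if_neg fun hm =>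
      (List.nodup_append.mp hnd.2.1).2.2 _ (List.mem_map_of_mem hl) _ hm rfl
    have e2 : K l.2 = 1 := if_pos (List.mem_map_of_mem hl)
    rw [e1, e2] at hz
    simp [binor] at hz
  · intro l hl
    exact if_neg fun hm => hnd.2.2 _ (List.mem_map_of_mem hl) _ (List.mem_append_right _ hm) rfl

end Coefficient

/-! ### Chains as averages of products of building blocks -/

section Chain

variable {n twok twoj : ℕ} {τ : Fin n → FermionType} {D D' : Diagram n twok twoj}
  {M N : Type*} [AddCommGroup M] [Module ℂ M] [AddCommGroup N] [Module ℂ N]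

theorem map_symmetrise {α : Type*} (φ : M →ₗ[ℂ] N) (l : List α) (f : List α → M) :
    φ (symmetrise l f) = symmetrise l fun l' => φ (f l') := by
  rw [symmetrise, symmetrise, map_smul, map_list_sum, List.map_map]
  rfl

/-- Dissolving a chain commutes with linear maps. -/
theorem map_dissolve (φ : M →ₗ[ℂ] N) (f : Diagram n twok twoj → M) (as : List (Fin n))
    (lines : List (Fin twok ⊕ Fin n)) (D : Diagram n twok twoj) :
    φ (dissolve τ f as lines D) = dissolve τ (fun D => φ (f D)) as lines D := by
  induction as generalizing lines D with
  | nil => rfl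
  | cons a as ih =>
    rw [dissolve, dissolve, map_symmetrise]
    congr 1
    funext l
    rcases τ a with _ | _
    · exact ih _ _
    · rcases l with _ | ⟨x, xs⟩
      · exact map_zero φ
      · exact ih _ _

theorem symmetrise_eq_of_forall {α : Type*} {l : List α} {f : List α → M} {y : M}
    (h : ∀ l', l'.Perm l → f l' = y) : symmetrise l f = y := by
  have h1 : l.permutations.map f = List.replicate l.length.factorial y := by
    rw [List.eq_replicate_iff]
    refine ⟨by rw [List.length_map, List.length_permutations], fun b hb => ?_⟩
    obtain ⟨l', hl', rfl⟩ := List.mem_map.mp hb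
    exact h l' (List.mem_permutations.mp hl')
  have h2 : ((l.length.factorial : ℕ) : ℂ) ≠ 0 := Nat.cast_ne_zero.mpr (Nat.factorial_ne_zero _)
  rw [symmetrise, h1, List.sum_replicate, ← Nat.cast_smul_eq_nsmul ℂ, smul_smul,
    inv_mul_cancel₀ h2, one_smul]

theorem chainSpin_succ (τ : Fin n → FermionType) (twok : ℕ) (a : Fin n) :
    chainSpin τ twok (a.1 + 1) =
      chainSpin τ twok a.1 + if τ a = FermionType.increasing then 1 else -1 := by
  have h (b : Fin n) : (if b.1 < a.1 + 1 then
      (if τ b = FermionType.increasing then (1 : ℤ) else -1) else 0) =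
      (if b.1 < a.1 then (if τ b = FermionType.increasing then 1 else -1) else 0) +
        if b = a then (if τ b = FermionType.increasing then 1 else -1) else 0 := by
    rcases lt_trichotomy b a with hb | rfl | hb
    · have : b.1 < a.1 := hb
      simp [this, hb.ne, Nat.lt_succ_of_lt this]
    · simp
    · have h1 : a.1 < b.1 := hb
      rw [if_neg (by omega), if_neg (by omega), if_neg hb.ne', add_zero]
  simp only [chainSpin, h, Finset.sum_add_distrib, Finset.sum_ite_eq', Finset.mem_univ, if_true]
  ring

/-- The situation after the first `i` fermions of a chain whose spin vanishes after the first `cut`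
fermions: `lines` are the lines of the present holonomy, and `D` is the part of the diagram that
is complete. Neither a line at the top point nor a line between fermions crosses the cut. -/
structure ChainState (τ : Fin n → FermionType) (cut i : ℕ) (lines : List (Fin twok ⊕ Fin n))
    (D : Diagram n twok twoj) : Prop where
  holonomies_eq : D.holonomies = []
  fermions_perm : (D.fermions ++ lines.filterMap Sum.getRight?).Perm ((List.finRange n).take i)
  outflow_perm : (D.legs.map Prod.snd ++ (lines.filterMap Sum.getLeft?).map Sum.inl).Perm
    ((List.finRange twok).map Sum.inl)
  legs : ∀ l ∈ D.legs, τ l.1 = FermionType.reducing ∧ l.1.1 < cut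
  links : ∀ l ∈ D.links, τ l.1 = FermionType.increasing ∧ τ l.2 = FermionType.reducing ∧
    (l.1.1 < cut ↔ l.2.1 < cut)
  lines_right : ∀ b, Sum.inr b ∈ lines → τ b = FermionType.increasing ∧ (cut ≤ i → cut ≤ b.1)
  lines_left : cut ≤ i → ∀ x, Sum.inl x ∉ lines
  length_eq : (lines.length : ℤ) = chainSpin τ twok i

/-- The diagrams that a chain dissolves into, where `cut` is the place at which the spin of the
chain vanishes. -/
structure IsChainDiagram (τ : Fin n → FermionType) (cut : ℕ) (D : Diagram n twok twoj) : Prop where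
  isBlockProduct : D.IsBlockProduct τ
  legs : ∀ l ∈ D.legs, (τ l.1 = FermionType.reducing ↔ l.1.1 < cut)
  links : ∀ l ∈ D.links, τ l.1 = FermionType.increasing ∧ τ l.2 = FermionType.reducing ∧
    (l.1.1 < cut ↔ l.2.1 < cut)

theorem ChainState.perm {cut i : ℕ} {lines lines' : List (Fin twok ⊕ Fin n)}
    (h : ChainState τ cut i lines D) (hp : lines'.Perm lines) : ChainState τ cut i lines' D where
  holonomies_eq := h.holonomies_eq
  fermions_perm := ((hp.filterMap _).append_left _).trans h.fermions_perm
  outflow_perm := (((hp.filterMap _).map _).append_left _).trans h.outflow_perm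
  legs := h.legs
  links := h.links
  lines_right := fun b hb => h.lines_right b (hp.mem_iff.mp hb)
  lines_left := fun hi x hx => h.lines_left hi x (hp.mem_iff.mp hx)
  length_eq := by rw [hp.length_eq, h.length_eq]

theorem ChainState.lt_of_mem {cut i : ℕ} {lines : List (Fin twok ⊕ Fin n)}
    (h : ChainState τ cut i lines D) {b : Fin n} (hb : Sum.inr b ∈ lines) : b.1 < i := by
  have h1 : b ∈ lines.filterMap Sum.getRight? := List.mem_filterMap.mpr ⟨_, hb, rfl⟩
  have h2 := h.fermions_perm.mem_iff.mp (List.mem_append_right _ h1)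
  obtain ⟨k, hk, rfl⟩ := List.getElem_of_mem h2
  simp only [List.getElem_take, List.getElem_finRange]
  simp only [List.length_take] at hk
  exact hk.trans_le (min_le_left _ _)

theorem take_succ_finRange (a : Fin n) :
    (List.finRange n).take (a.1 + 1) = (List.finRange n).take a.1 ++ [a] := by
  rw [List.take_succ_eq_append_getElem (by simp)]
  simp

theorem ChainState.increase {cut : ℕ} {a : Fin n} {lines : List (Fin twok ⊕ Fin n)}
    (h : ChainState τ cut a.1 lines D) (ha : τ a = FermionType.increasing)
    (hcut : chainSpin τ twok cut = 0) :
    ChainState τ cut (a.1 + 1) (lines ++ [Sum.inr a]) D := by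
  have hlen : ((lines ++ [Sum.inr a]).length : ℤ) = chainSpin τ twok (a.1 + 1) := by
    rw [chainSpin_succ, if_pos ha, ← h.length_eq]
    simp
  -- The spin above the cut cannot be increased to zero.
  have hle (hc : cut ≤ a.1 + 1) : cut ≤ a.1 := by
    rcases hc.lt_or_eq with hc | rfl
    · omega
    · rw [hcut] at hlen
      simp at hlen
      omega
  exact
  { holonomies_eq := h.holonomies_eq
    fermions_perm := by
      rw [take_succ_finRange, List.filterMap_append, ← List.append_assoc]
      exact h.fermions_perm.append_right _
    outflow_perm := by
      have e : [(Sum.inr a : Fin twok ⊕ Fin n)].filterMap Sum.getLeft? = [] := rfl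
      rw [List.filterMap_append, e, List.append_nil]
      exact h.outflow_perm
    legs := h.legs
    links := h.links
    lines_right := by
      intro b hb
      rcases List.mem_append.mp hb with hb | hb
      · exact ⟨(h.lines_right b hb).1, fun hc => (h.lines_right b hb).2 (hle hc)⟩
      · obtain rfl : b = a := by simpa using hb
        exact ⟨ha, hle⟩
    lines_left := by
      intro hc x hx
      rcases List.mem_append.mp hx with hx | hx
      · exact h.lines_left (hle hc) x hx
      · simp at hx
    length_eq := hlen }

theorem ChainState.reduce {cut : ℕ} {a : Fin n} {x : Fin twok ⊕ Fin n}
    {lines : List (Fin twok ⊕ Fin n)} (h : ChainState τ cut a.1 (x :: lines) D)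
    (ha : τ a = FermionType.reducing) (hcut : chainSpin τ twok cut = 0) :
    ChainState τ cut (a.1 + 1) lines (D.endAt x a) := by
  have hlen : (lines.length : ℤ) = chainSpin τ twok (a.1 + 1) := by
    have := h.length_eq
    rw [chainSpin_succ, ha, ← this]
    simp
  -- There are no lines left at the cut.
  have hle (hc : cut ≤ a.1 + 1) : lines = [] ∨ cut ≤ a.1 := by
    rcases hc.lt_or_eq with hc | rfl
    · exact Or.inr (by omega)
    · rw [hcut] at hlen
      exact Or.inl (List.length_eq_zero_iff.mp (by exact_mod_cast hlen))
  have hright : ∀ b, Sum.inr b ∈ lines →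
      τ b = FermionType.increasing ∧ (cut ≤ a.1 + 1 → cut ≤ b.1) := by
    intro b hb
    have hb' := h.lines_right b (List.mem_cons_of_mem _ hb)
    refine ⟨hb'.1, fun hc => ?_⟩
    rcases hle hc with rfl | hc
    · simp at hb
    · exact hb'.2 hc
  have hleft : cut ≤ a.1 + 1 → ∀ x, Sum.inl x ∉ lines := by
    intro hc y hy
    rcases hle hc with rfl | hc
    · simp at hy
    · exact h.lines_left hc y (List.mem_cons_of_mem _ hy)
  have hf := h.fermions_perm
  have ho := h.outflow_perm
  rcases x with i | b
  · exact
    { holonomies_eq := h.holonomies_eq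
      fermions_perm := by
        rw [take_succ_finRange]
        refine List.Perm.trans ?_ (List.perm_append_singleton _ _).symm
        exact List.Perm.cons _ hf
      outflow_perm := List.perm_middle.symm.trans ho
      legs := by
        intro l hl
        rcases List.mem_cons.mp hl with rfl | hl
        · refine ⟨ha, ?_⟩
          by_contra hc
          exact h.lines_left (not_lt.mp hc) i List.mem_cons_self
        · exact h.legs l hl
      links := h.links
      lines_right := hright
      lines_left := hleft
      length_eq := hlen }
  · exact
    { holonomies_eq := h.holonomies_eq
      fermions_perm := by
        rw [take_succ_finRange]
        refine List.Perm.trans ?_ (hf.append_right _)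
        rw [List.perm_iff_count]
        intro c
        simp only [Diagram.endAt, Diagram.fermions, List.map_cons, List.count_append,
          List.count_cons, List.filterMap_cons, Sum.getRight?_inr, List.count_nil]
        omega
      outflow_perm := ho
      legs := h.legs
      links := by
        intro l hl
        rcases List.mem_cons.mp hl with rfl | hl
        · have hb := h.lines_right b List.mem_cons_self
          have hlt := h.lt_of_mem (b := b) List.mem_cons_self
          refine ⟨hb.1, ha, ?_⟩
          have := hb.2
          dsimp only
          omega
        · exact h.links l hl
      lines_right := hright
      lines_left := hleft
      length_eq := hlen }

theorem foldl_leave (D : Diagram n twok twoj) (l : List (Fin n × Fin twoj)) :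
    (l.map fun c => ((Sum.inr c.1 : Fin twok ⊕ Fin n), c.2)).foldl Diagram.leave D =
      { D with legs := (l.map fun c => (c.1, Sum.inr c.2)).reverse ++ D.legs } := by
  induction l generalizing D with
  | nil => rfl
  | cons c l ih =>
    rw [List.map_cons, List.foldl_cons, ih]
    simp [Diagram.leave]

/-- At the end of the chain the remaining lines all come from increasing fermions below the cut, and
they become the bottom legs. -/
theorem ChainState.isChainDiagram {cut : ℕ} {lines : List (Fin twok ⊕ Fin n)}
    (h : ChainState τ cut n lines D) (hcut : cut ≤ n) (hbot : chainSpin τ twok n = twoj) :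
    IsChainDiagram τ cut ((lines.zip (List.finRange twoj)).foldl Diagram.leave D) := by
  obtain ⟨bs, rfl⟩ : ∃ bs : List (Fin n), lines = bs.map Sum.inr := by
    refine ⟨lines.filterMap Sum.getRight?, ?_⟩
    have := h.lines_left hcut
    clear h
    induction lines with
    | nil => rfl
    | cons x l ih =>
      rcases x with i | b
      · exact absurd List.mem_cons_self (this i)
      · have := ih fun x hx => this x (List.mem_cons_of_mem _ hx)
        simpa using this
  have hlen : bs.length = twoj := by
    have := h.length_eq
    rw [hbot, List.length_map] at this
    exact_mod_cast this
  have hz : (bs.map (Sum.inr : Fin n → Fin twok ⊕ Fin n)).zip (List.finRange twoj) =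
      (bs.zip (List.finRange twoj)).map fun c => (Sum.inr c.1, c.2) := by
    rw [List.zip_map_left]
    rfl
  rw [hz, foldl_leave]
  set Z := bs.zip (List.finRange twoj) with hZ
  have hZ1 : Z.map Prod.fst = bs := List.map_fst_zip (by simp [hlen])
  have hZ2 : Z.map Prod.snd = List.finRange twoj := List.map_snd_zip (by simp [hlen])
  set L : List (Fin n × Outflow twok twoj) :=
    (Z.map fun c => (c.1, Sum.inr c.2)).reverse ++ D.legs with hL
  have hmem : ∀ l ∈ L, (∃ c ∈ Z, l = (c.1, Sum.inr c.2)) ∨ l ∈ D.legs := by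
    intro l hl
    rcases List.mem_append.mp hl with hl | hl
    · rw [List.mem_reverse] at hl
      obtain ⟨c, hc, rfl⟩ := List.mem_map.mp hl
      exact Or.inl ⟨c, hc, rfl⟩
    · exact Or.inr hl
  have hinr : ∀ c ∈ Z, τ c.1 = FermionType.increasing ∧ cut ≤ c.1.1 := by
    intro c hc
    have hb : c.1 ∈ bs := hZ1 ▸ List.mem_map_of_mem hc
    have := h.lines_right c.1 (List.mem_map_of_mem hb)
    exact ⟨this.1, this.2 hcut⟩
  have hleg : ∀ l ∈ D.legs, ∃ i, l.2 = Sum.inl i := by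
    intro l hl
    have := h.outflow_perm.mem_iff.mp (List.mem_append_left _ (List.mem_map_of_mem hl))
    obtain ⟨i, -, hi⟩ := List.mem_map.mp this
    exact ⟨i, hi.symm⟩
  have hL1 : (L.map Prod.fst).Perm (bs ++ D.legs.map Prod.fst) := by
    rw [hL, List.map_append, List.map_reverse, List.map_map, ← hZ1]
    exact (List.reverse_perm _).append_right _
  have hL2 : (L.map Prod.snd).Perm
      ((List.finRange twoj).map Sum.inr ++ (List.finRange twok).map Sum.inl) := by
    rw [hL, List.map_append, List.map_reverse, List.map_map, ← hZ2, List.map_map]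
    refine (List.reverse_perm _).append ?_
    have := h.outflow_perm
    rwa [List.filterMap_map, List.filterMap_eq_nil_iff.mpr (by simp), List.map_nil,
      List.append_nil] at this
  have hf : (L.map Prod.fst ++ (D.links.map Prod.fst ++ D.links.map Prod.snd)).Perm
      (List.finRange n) := by
    have := h.fermions_perm
    rw [List.take_of_length_le (by simp), List.filterMap_map] at this
    have e : bs.filterMap (Sum.getRight? ∘ (Sum.inr : Fin n → Fin twok ⊕ Fin n)) = bs :=
      List.filterMap_some
    rw [e] at this
    refine List.Perm.trans ?_ this
    refine (hL1.append_right _).trans ?_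
    rw [List.append_assoc]
    exact List.perm_append_comm
  refine ⟨⟨h.holonomies_eq, hf.nodup_iff.mpr (List.nodup_finRange n),
    fun a => hf.mem_iff.mpr (List.mem_finRange a), hL2.nodup_iff.mpr ?_, ?_, ?_, ?_, ?_⟩, ?_, h.links⟩
  · refine List.nodup_append.mpr ⟨(List.nodup_finRange _).map Sum.inr_injective,
      (List.nodup_finRange _).map Sum.inl_injective, ?_⟩
    intro x hx y hy
    obtain ⟨i, -, rfl⟩ := List.mem_map.mp hx
    obtain ⟨j, -, rfl⟩ := List.mem_map.mp hy
    simp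
  · intro s
    rw [hL2.mem_iff]
    rcases s with s | s <;> simp
  · intro a i hl
    rcases hmem _ hl with ⟨c, -, hc⟩ | hl
    · simp at hc
    · exact (h.legs _ hl).1
  · intro a i hl
    rcases hmem _ hl with ⟨c, hc, hc'⟩ | hl
    · rw [(Prod.mk.inj hc').1]
      exact (hinr c hc).1
    · obtain ⟨j, hj⟩ := hleg _ hl
      simp at hj
  · intro l hl
    obtain ⟨h1, h2, -⟩ := h.links l hl
    rw [h1, h2]
    simp
  · intro l hl
    rcases hmem _ hl with ⟨c, hc, rfl⟩ | hl
    · have := hinr c hc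
      simp [this.1, this.2]
    · have := h.legs _ hl
      simp [this.1, this.2]

theorem dissolve_eq_of_chainState (hτ : IsChain τ twok twoj) {cut : ℕ} (hcut : cut ≤ n)
    (hcut0 : chainSpin τ twok cut = 0) {f : Diagram n twok twoj → M} {y : M}
    (hf : ∀ D, IsChainDiagram τ cut D → f D = y) (as : List (Fin n)) (i : ℕ) (hi : i ≤ n)
    (has : as = (List.finRange n).drop i) (lines : List (Fin twok ⊕ Fin n))
    (D : Diagram n twok twoj) (h : ChainState τ cut i lines D) : dissolve τ f as lines D = y := by
  induction as generalizing i lines D with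
  | nil =>
    have : n ≤ i := by simpa using has.symm
    obtain rfl : i = n := le_antisymm hi this
    exact hf _ (h.isChainDiagram hcut hτ.bottom)
  | cons a as ih =>
    have hin : i < n := by
      by_contra hc
      rw [List.drop_of_length_le (by simpa using hc)] at has
      simp at has
    rw [List.drop_eq_getElem_cons (by simpa using hin)] at has
    obtain ⟨ha, has⟩ := List.cons.inj has
    obtain rfl : a.1 = i := by simp [ha]
    rw [dissolve]
    refine symmetrise_eq_of_forall fun l hl => ?_
    have hl' := h.perm hl
    cases hta : τ a with
    | increasing => exact ih _ hin has _ _ (hl'.increase hta hcut0)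
    | reducing =>
      rcases l with _ | ⟨x, xs⟩
      -- The spin below a reducing fermion is nonnegative, so that a line ends at it.
      · have h1 := hl'.length_eq
        have h2 := hτ.nonneg (a.1 + 1) hin
        rw [chainSpin_succ, hta, ← h1] at h2
        simp at h2
      · exact ih _ hin has _ _ (hl'.reduce hta hcut0)

/-- A chain is an average of products of building blocks: if a quantity has the same value on all of
them, this is also its value on the chain. -/
theorem IsChain.dissolve_eq (hτ : IsChain τ twok twoj) {cut : ℕ} (hcut : cut ≤ n)
    (hcut0 : chainSpin τ twok cut = 0) {f : Diagram n twok twoj → M} {y : M}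
    (hf : ∀ D, IsChainDiagram τ cut D → f D = y) :
    dissolve τ f (List.finRange n) ((List.finRange twok).map Sum.inl) ⟨[], [], []⟩ = y := by
  refine dissolve_eq_of_chainState hτ hcut hcut0 hf _ 0 (Nat.zero_le n) rfl _ _ ?_
  have hspin : chainSpin τ twok 0 = twok := by simp [chainSpin]
  exact
  { holonomies_eq := rfl
    fermions_perm := by
      rw [List.filterMap_map, List.filterMap_eq_nil_iff.mpr (by simp)]
      exact List.Perm.refl _
    outflow_perm := by
      rw [List.filterMap_map]
      have e : (List.finRange twok).filterMap
          (Sum.getLeft? ∘ (Sum.inl : Fin twok → Fin twok ⊕ Fin n)) = List.finRange twok :=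
        List.filterMap_some
      rw [e]
      exact List.Perm.refl _
    legs := by simp
    links := by simp
    lines_right := by simp
    lines_left := by
      intro hc x hx
      obtain rfl : cut = 0 := by omega
      rw [hspin] at hcut0
      exact absurd x.2 (by omega)
    length_eq := by rw [hspin]; simp }

/-- The spinor indices of the fermions at which all the diagrams of a chain have the same nonzero
coefficient. A fermion on a leg has index `0`, and the two fermions of a link have different
indices, depending on the side of the cut. -/
noncomputable def chainIndex (τ : Fin n → FermionType) (cut : ℕ) (a : Fin n) : Fin 2 :=
  open Classical in if (τ a = FermionType.reducing ↔ a.1 < cut) then 0 else 1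

/-- The contribution of a fermion to the coefficient at `chainIndex`: the sign of a link is
assigned to its fermion of index `1`. -/
noncomputable def chainFactor (τ : Fin n → FermionType) (cut : ℕ) (a : Fin n) : ℂ :=
  if chainIndex τ cut a = 0 then 1 else if a.1 < cut then -Complex.I else Complex.I

theorem IsChainDiagram.weight_chainIndex {cut : ℕ} (h : IsChainDiagram τ cut D) :
    D.weight (R := ℂ) (fun _ => 1) 0 (chainIndex τ cut) = ∏ a, chainFactor τ cut a := by
  have hlegs : ∀ l ∈ D.legs, chainIndex τ cut l.1 = 0 := fun l hl => if_pos (h.legs l hl)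
  rw [Diagram.weight_one_zero h.isBlockProduct.holonomies_eq hlegs,
    h.isBlockProduct.isProper.prod_fermions]
  have h1 : ∀ l ∈ D.legs, chainFactor τ cut l.1 = 1 := fun l hl => if_pos (hlegs l hl)
  have h2 : ∀ l ∈ D.links, chainFactor τ cut l.1 * chainFactor τ cut l.2 =
      binor (chainIndex τ cut l.1) (chainIndex τ cut l.2) := by
    intro l hl
    obtain ⟨e1, e2, e3⟩ := h.links l hl
    by_cases hc : l.2.1 < cut
    · simp [chainFactor, chainIndex, e1, e2, e3.mpr hc, hc, binor]
    · simp [chainFactor, chainIndex, e1, e2, mt e3.mp hc, hc, binor]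
  rw [List.map_congr_left h1, List.map_congr_left h2]
  simp

theorem prod_chainFactor_ne_zero (τ : Fin n → FermionType) (cut : ℕ) :
    ∏ a, chainFactor τ cut a ≠ 0 := by
  refine Finset.prod_ne_zero_iff.mpr fun a _ => ?_
  unfold chainFactor
  split_ifs <;> simp

end Chain

section Eigenstate

variable {Pt : Type u} [Groupoid.{v} Pt] {n twok twoj : ℕ} {E : EdgeSet Pt n} {top bot : Pt}
  {p : E.target ⟶ top} {q : E.target ⟶ bot} {τ : Fin n → FermionType}

theorem map_symm_chainSeries {N : Type*} [AddCommGroup N] [Module ℂ N] (φ : States Pt →ₗ[ℂ] N)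
    (A : Outflow twok twoj → Fin 2) :
    φ (symmOutflow _ _ _ (chainSeries E p q τ twok twoj) A) =
      dissolve τ (fun D => φ (symmOutflow _ _ _ (D.series E p q τ) A)) (List.finRange n)
        ((List.finRange twok).map Sum.inl) ⟨[], [], []⟩ := by
  have h : chainSeries E p q τ twok twoj = dissolve τ (fun D => D.series E p q τ)
      (List.finRange n) ((List.finRange twok).map Sum.inl) ⟨[], [], []⟩ := by
    funext A
    exact (map_dissolve (M := (Outflow twok twoj → Fin 2) → States Pt)
      (LinearMap.proj (φ := fun _ => States Pt) A) (fun D => D.series E p q τ) _ _ _).symm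
  rw [h]
  exact map_dissolve (M := (Outflow twok twoj → Fin 2) → States Pt)
    (φ ∘ₗ LinearMap.proj A ∘ₗ symmOutflow (States Pt) twok twoj) (fun D => D.series E p q τ) _ _ _

theorem IsChain.isSpinEigenstate (hτ : IsChain τ twok twoj) :
    IsSpinEigenstate E (((twoj : ℂ) / 2) + ((twok : ℂ) / 2))
      (symmetriseOutflow (chainSeries E p q τ twok twoj)) := by
  obtain ⟨cut, hcut, hcut0⟩ := hτ.no_pure_holonomy
  rw [← symmOutflow_apply]
  constructor
  · intro A
    have h := map_symm_chainSeries (τ := τ) (p := p) (q := q) (totalSpinSq E -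
      (((twoj : ℂ) / 2 + (twok : ℂ) / 2) * ((twoj : ℂ) / 2 + (twok : ℂ) / 2 + 1)) •
        LinearMap.id) A
    rw [hτ.dissolve_eq hcut hcut0 (y := 0)] at h
    · exact sub_eq_zero.mp h
    · intro D hD
      exact sub_eq_zero.mpr (hD.isBlockProduct.isProper.totalSpinSq_symm_series
        hD.isBlockProduct.length_legs A)
  · intro h0
    have h := map_symm_chainSeries (τ := τ) (twok := twok) (twoj := twoj) (p := p) (q := q)
      (coefficientAt E (chainIndex τ cut)) 0
    rw [h0, Pi.zero_apply, map_zero,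
      hτ.dissolve_eq hcut hcut0 (y := ∏ a, chainFactor τ cut a)] at h
    · exact prod_chainFactor_ne_zero τ cut h.symm
    · intro D hD
      rw [hD.isBlockProduct.isProper.coefficientAt_symm_series, hD.weight_chainIndex]

theorem Diagram.IsBlockProduct.isSpinEigenstate {D : Diagram n twok twoj}
    (hD : D.IsBlockProduct τ) :
    IsSpinEigenstate E (((twoj : ℂ) / 2) + ((twok : ℂ) / 2))
      (symmetriseOutflow (D.series E p q τ)) :=
  ⟨fun A => hD.isProper.totalSpinSq_symm_series hD.length_legs A, hD.symm_series_ne_zero⟩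

end Eigenstate
end LoopSpin

theorem proposition2 {Pt : Type*} [CategoryTheory.Groupoid Pt] {n : ℕ}
    (E : LoopSpin.EdgeSet Pt n) {top bot : Pt} (p : E.target ⟶ top) (q : E.target ⟶ bot)
    (τ : Fin n → LoopSpin.FermionType) (twok twoj : ℕ) :
    (LoopSpin.IsChain τ twok twoj →
      LoopSpin.IsSpinEigenstate E (((twoj : ℂ) / 2) + ((twok : ℂ) / 2))
        (LoopSpin.symmetriseOutflow (LoopSpin.chainSeries E p q τ twok twoj))) ∧
    (∀ D : LoopSpin.Diagram n twok twoj, D.IsBlockProduct τ →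
      LoopSpin.IsSpinEigenstate E (((twoj : ℂ) / 2) + ((twok : ℂ) / 2))
        (LoopSpin.symmetriseOutflow (D.series E p q τ))) :=
  ⟨fun hτ => hτ.isSpinEigenstate, fun _ hD => hD.isSpinEigenstate⟩
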